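/- Let $R$ be an integral domain (commutative, with unit) which is not a field and such that for every $m\in R^\times:=R\setminus\{0\}$ the principal ideal $(m)$ has finite index in $R$. Let $\mathfrak{A}[R]$ be the universal unital C*-algebra generated by isometries $s_m$ ($m\in R^\times$) and unitaries $u^n$ ($n\in R$) subject to the relations 1. $s_k s_m=s_{km}$, 2. $u^l u^n=u^{l+n}$, 3. $s_m u^n=u^{mn}s_m$, 4. $\sum_{n+(m)\in R/(m)}u^n e_m u^{-n}=1$, where $e_m=s_ms_m^*$ and the sum is taken over a complete system of representatives $n$ of the cosets of $(m)$ in $R$ (given 1.–3., the summands do not depend on the choice of representatives), for all $k,m\in R^\times$ and $l,n\in R$. That is, $\mathfrak{A}[R]$ is the completion of the free unital complex *-algebra on these symbols with respect to the seminorm that assigns to a *-polynomial the supremum of the norms of its images under all families in unital C*-algebras satisfying these relations. Then $\mathfrak{A}[R]$ is simple, i.e. $\mathfrak{A}[R]\neq 0$ and its only closed two-sided ideals are $0$ and $\mathfrak{A}[R]$, and purely infinite, i.e. $\mathfrak{A}[R]\not\cong\mathbb{C}$ and for every $0\neq x\in\mathfrak{A}[R]$ there are $a,b\in\mathfrak{A}[R]$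 with $axb=1$. -/

import Mathlib

universe u

open scoped nonZeroDivisors

noncomputable section

namespace AxbAlgebra

/-! ### The relations -/

/-- The defining relations, for a family `s` indexed by the nonzero elements of `R` and a family `v`
indexed by `R` (`v n` stands for `u^n`): the `s m` are isometries, the `v n` are unitaries, and
the four `ax+b` relations hold. In the last one, `T` is a complete system of representatives of
`R / (m)`, so that the sum is the sum over all cosets `n + (m)`. -/
structure Relations {R : Type*} [CommRing R] {B : Type*} [Ring B] [StarRing B]
    (s : R⁰ → B) (v : R → B) : Prop where
  isometry : ∀ m, star (s m) * s m = 1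
  unitary : ∀ n, v n ∈ unitary B
  s_mul : ∀ k m, s k * s m = s (k * m)
  v_add : ∀ l n, v l * v n = v (l + n)
  s_v : ∀ (m : R⁰) (n : R), s m * v n = v ((m : R) * n) * s m
  sum_cosets : ∀ (m : R⁰) (T : Finset R),
    Set.BijOn (Ideal.Quotient.mk (Ideal.span {(m : R)})) (T : Set R) Set.univ →
      ∑ n ∈ T, v n * (s m * star (s m)) * v (-n) = 1

/-! ### The free unital complex *-algebra on a set -/

/-- The free unital complex *-algebra on `X`: noncommutative polynomials in symbols `x` and `x^*`,
where `(x, false)` is the symbol `x` and `(x, true)` is the symbol `x^*`. -/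
def FreeStarAlgebra (X : Type u) : Type u := FreeAlgebra ℂ (X × Bool)

namespace FreeStarAlgebra

variable {X : Type u}

instance : Ring (FreeStarAlgebra X) := inferInstanceAs (Ring (FreeAlgebra ℂ (X × Bool)))

instance : Algebra ℂ (FreeStarAlgebra X) :=
  inferInstanceAs (Algebra ℂ (FreeAlgebra ℂ (X × Bool)))

/-- The symbols `x` and `x^*`. -/
def sym (x : X × Bool) : FreeStarAlgebra X := FreeAlgebra.ι ℂ x

/-- The generator `x`. -/
def gen (x : X) : FreeStarAlgebra X := sym (x, false)

theorem induction {motive : FreeStarAlgebra X → Prop}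
    (scalar : ∀ r : ℂ, motive (algebraMap ℂ (FreeStarAlgebra X) r)) (sym : ∀ x, motive (sym x))
    (mul : ∀ a b, motive a → motive b → motive (a * b))
    (add : ∀ a b, motive a → motive b → motive (a + b))
    (a : FreeStarAlgebra X) : motive a :=
  FreeAlgebra.induction ℂ (X × Bool) scalar sym mul add a

/-- The algebra homomorphism out of the free algebra given by the images of all symbols. -/
def liftSym {B : Type*} [Ring B] [Algebra ℂ B] (g : X × Bool → B) : FreeStarAlgebra X →ₐ[ℂ] B :=
  FreeAlgebra.lift ℂ g

@[simp]
theorem liftSym_sym {B : Type*} [Ring B] [Algebra ℂ B] (g : X × Bool → B) (x : X × Bool) :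
    liftSym g (sym x) = g x :=
  FreeAlgebra.lift_ι_apply g x

/-- The conjugate-linear anti-multiplicative map that exchanges the symbols `x` and `x^*`. -/
def conjRev : FreeStarAlgebra X →+* (FreeStarAlgebra X)ᵐᵒᵖ :=
  letI : Algebra ℂ (FreeStarAlgebra X)ᵐᵒᵖ :=
    Algebra.compHom (FreeStarAlgebra X)ᵐᵒᵖ (starRingEnd ℂ)
  (liftSym fun x : X × Bool => MulOpposite.op (sym (x.1, !x.2)) :
    FreeStarAlgebra X →ₐ[ℂ] (FreeStarAlgebra X)ᵐᵒᵖ).toRingHom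

theorem conjRev_sym (x : X × Bool) : conjRev (sym x) = MulOpposite.op (sym (x.1, !x.2)) :=
  letI : Algebra ℂ (FreeStarAlgebra X)ᵐᵒᵖ :=
    Algebra.compHom (FreeStarAlgebra X)ᵐᵒᵖ (starRingEnd ℂ)
  liftSym_sym _ x

theorem conjRev_algebraMap (r : ℂ) :
    conjRev (algebraMap ℂ (FreeStarAlgebra X) r) =
      MulOpposite.op (algebraMap ℂ (FreeStarAlgebra X) (star r)) :=
  letI : Algebra ℂ (FreeStarAlgebra X)ᵐᵒᵖ :=
    Algebra.compHom (FreeStarAlgebra X)ᵐᵒᵖ (starRingEnd ℂ)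
  AlgHom.commutes (liftSym fun x : X × Bool => MulOpposite.op (sym (x.1, !x.2)) :
    FreeStarAlgebra X →ₐ[ℂ] (FreeStarAlgebra X)ᵐᵒᵖ) r

instance : StarRing (FreeStarAlgebra X) where
  star a := (conjRev a).unop
  star_involutive a := by
    induction a using FreeStarAlgebra.induction with
    | scalar r => simp [conjRev_algebraMap]
    | sym x => simp [conjRev_sym]
    | mul a b ha hb => simp [ha, hb]
    | add a b ha hb => simp [ha, hb]
  star_mul a b := by simp
  star_add a b := by simp

theorem star_sym (x : X × Bool) : star (sym x) = sym (x.1, !x.2) := by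
  change (conjRev (sym x)).unop = _
  rw [conjRev_sym, MulOpposite.unop_op]

theorem star_algebraMap (r : ℂ) :
    star (algebraMap ℂ (FreeStarAlgebra X) r) = algebraMap ℂ (FreeStarAlgebra X) (star r) := by
  change (conjRev _).unop = _
  rw [conjRev_algebraMap, MulOpposite.unop_op]

instance : StarModule ℂ (FreeStarAlgebra X) where
  star_smul r a := by
    rw [Algebra.smul_def, star_mul, star_algebraMap, Algebra.smul_def, Algebra.commutes]

/-- The evaluation of noncommutative *-polynomials at a family `g` of elements of a *-algebra. -/
def eval {B : Type*} [Ring B] [StarRing B] [Algebra ℂ B] [StarModule ℂ B] (g : X → B) :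
    FreeStarAlgebra X →⋆ₐ[ℂ] B where
  __ := liftSym fun x : X × Bool => if x.2 then star (g x.1) else g x.1
  map_star' a := by
    change liftSym _ (star a) = star (liftSym _ a)
    induction a using FreeStarAlgebra.induction with
    | scalar r => rw [star_algebraMap, AlgHom.commutes, AlgHom.commutes, algebraMap_star_comm]
    | sym x => rcases x with ⟨x, _ | _⟩ <;> simp [star_sym]
    | mul a b ha hb => rw [star_mul, map_mul, ha, hb, map_mul, star_mul]
    | add a b ha hb => rw [star_add, map_add, ha, hb, map_add, star_add]

theorem eval_sym {B : Type*} [Ring B] [StarRing B] [Algebra ℂ B] [StarModule ℂ B] (g : X → B)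
    (x : X × Bool) : eval g (sym x) = if x.2 then star (g x.1) else g x.1 :=
  liftSym_sym _ x

@[simp]
theorem eval_gen {B : Type*} [Ring B] [StarRing B] [Algebra ℂ B] [StarModule ℂ B] (g : X → B)
    (x : X) : eval g (gen x) = g x := by
  simp [gen, eval_sym]

end FreeStarAlgebra

/-! ### The universal C*-seminorm -/

/-- The free *-algebra on the symbols `s_m`, `m` a nonzero element of `R`, and `u^n`, `n ∈ R`. -/
def StarPoly (R : Type u) [CommRing R] : Type u := FreeStarAlgebra (R⁰ ⊕ R)

namespace StarPoly

variable (R : Type u) [CommRing R]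

instance : Ring (StarPoly R) := inferInstanceAs (Ring (FreeStarAlgebra (R⁰ ⊕ R)))

instance : Algebra ℂ (StarPoly R) := inferInstanceAs (Algebra ℂ (FreeStarAlgebra (R⁰ ⊕ R)))

instance : StarRing (StarPoly R) := inferInstanceAs (StarRing (FreeStarAlgebra (R⁰ ⊕ R)))

instance : StarModule ℂ (StarPoly R) := inferInstanceAs (StarModule ℂ (FreeStarAlgebra (R⁰ ⊕ R)))

variable {R}

/-- Evaluation of *-polynomials at `s_m ↦ s m`, `u^n ↦ v n`. -/
def eval {B : Type*} [CStarAlgebra B] (s : R⁰ → B) (v : R → B) : StarPoly R →⋆ₐ[ℂ] B :=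
  FreeStarAlgebra.eval (Sum.elim s v)

/-- The norms of all images of `a` in representations of the relations in C*-algebras. Every
C*-algebra generated by a family satisfying the relations is isomorphic to one in the universe
of `R`, so the universe restriction does not matter. -/
def normSet (a : StarPoly R) : Set ℝ :=
  {r | ∃ (B : Type u) (_ : CStarAlgebra B) (s : R⁰ → B) (v : R → B),
    Relations s v ∧ r = ‖eval s v a‖}

/-- The universal C*-seminorm. -/
def univNorm (a : StarPoly R) : ℝ := sSup (normSet a)

theorem norm_one_le {B : Type*} [CStarAlgebra B] : ‖(1 : B)‖ ≤ 1 := by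
  rcases subsingleton_or_nontrivial B with h | h
  · rw [Subsingleton.elim (1 : B) 0, norm_zero]
    exact zero_le_one
  · exact CStarRing.norm_one.le

theorem norm_le_one_of_isometry {B : Type*} [CStarAlgebra B] {w : B} (h : star w * w = 1) :
    ‖w‖ ≤ 1 := by
  have h1 : ‖w‖ * ‖w‖ ≤ 1 := by
    rw [← CStarRing.norm_star_mul_self, h]
    exact norm_one_le
  nlinarith [norm_nonneg w]

theorem bddAbove_normSet (a : StarPoly R) : BddAbove (normSet a) := by
  suffices h : ∃ C : ℝ, ∀ (B : Type u) (_ : CStarAlgebra B) (s : R⁰ → B) (v : R → B),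
      Relations s v → ‖eval s v a‖ ≤ C by
    obtain ⟨C, hC⟩ := h
    refine ⟨C, ?_⟩
    rintro r ⟨B, _, s, v, h, rfl⟩
    exact hC B _ s v h
  induction a using FreeStarAlgebra.induction with
  | scalar r =>
    refine ⟨‖r‖, fun B _ s v _ => ?_⟩
    have : eval s v (algebraMap ℂ (StarPoly R) r) = algebraMap ℂ B r := AlgHomClass.commutes _ r
    erw [this]
    rw [Algebra.algebraMap_eq_smul_one]
    refine (norm_smul_le _ _).trans ?_
    exact mul_le_of_le_one_right (norm_nonneg _) norm_one_le
  | sym x =>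
    refine ⟨1, fun B _ s v h => ?_⟩
    have : eval s v (FreeStarAlgebra.sym x) =
        if x.2 then star (Sum.elim s v x.1) else Sum.elim s v x.1 := FreeStarAlgebra.eval_sym _ x
    rw [this]
    have h1 : ‖Sum.elim s v x.1‖ ≤ 1 := by
      rcases x.1 with m | n
      · exact norm_le_one_of_isometry (h.isometry m)
      · exact norm_le_one_of_isometry (Unitary.star_mul_self_of_mem (h.unitary n))
    split_ifs
    · rwa [norm_star]
    · exact h1
  | mul a b ha hb =>
    obtain ⟨C, hC⟩ := ha
    obtain ⟨D, hD⟩ := hb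
    refine ⟨C * D, fun B _ s v h => ?_⟩
    have : eval s v (a * b) = eval s v a * eval s v b := map_mul (eval s v) _ _
    erw [this]
    refine (norm_mul_le _ _).trans ?_
    exact mul_le_mul (hC B _ s v h) (hD B _ s v h) (norm_nonneg _)
      ((norm_nonneg _).trans (hC B _ s v h))
  | add a b ha hb =>
    obtain ⟨C, hC⟩ := ha
    obtain ⟨D, hD⟩ := hb
    refine ⟨C + D, fun B _ s v h => ?_⟩
    have : eval s v (a + b) = eval s v a + eval s v b := map_add (eval s v) _ _
    erw [this]
    exact (norm_add_le _ _).trans (add_le_add (hC B _ s v h) (hD B _ s v h))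

theorem norm_eval_le {B : Type u} [CStarAlgebra B] {s : R⁰ → B} {v : R → B}
    (h : Relations s v) (a : StarPoly R) : ‖eval s v a‖ ≤ univNorm a :=
  le_csSup (bddAbove_normSet a) ⟨B, _, s, v, h, rfl⟩

theorem univNorm_nonneg (a : StarPoly R) : 0 ≤ univNorm a := by
  refine Real.sSup_nonneg ?_
  rintro r ⟨B, _, s, v, -, rfl⟩
  exact norm_nonneg _

theorem univNorm_le {a : StarPoly R} {C : ℝ} (hC : 0 ≤ C)
    (h : ∀ (B : Type u) (_ : CStarAlgebra B) (s : R⁰ → B) (v : R → B),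
      Relations s v → ‖eval s v a‖ ≤ C) : univNorm a ≤ C := by
  refine Real.sSup_le ?_ hC
  rintro r ⟨B, _, s, v, hr, rfl⟩
  exact h B _ s v hr

variable (R) in
/-- The universal C*-seminorm as a ring seminorm. -/
def univSeminorm : RingSeminorm (StarPoly R) where
  toFun := univNorm
  map_zero' := le_antisymm (univNorm_le le_rfl fun B _ s v _ => by simp) (univNorm_nonneg _)
  add_le' a b := univNorm_le (add_nonneg (univNorm_nonneg a) (univNorm_nonneg b))
    fun B _ s v h => by
      rw [map_add]
      exact (norm_add_le _ _).trans (add_le_add (norm_eval_le h a) (norm_eval_le h b))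
  neg' a := by simp [univNorm, normSet]
  mul_le' a b := univNorm_le (mul_nonneg (univNorm_nonneg a) (univNorm_nonneg b))
    fun B _ s v h => by
      rw [map_mul]
      exact (norm_mul_le _ _).trans (mul_le_mul (norm_eval_le h a) (norm_eval_le h b)
        (norm_nonneg _) (univNorm_nonneg a))

instance : SeminormedRing (StarPoly R) := (univSeminorm R).toSeminormedRing

theorem norm_def (a : StarPoly R) : ‖a‖ = univNorm a := rfl

instance : NormedAlgebra ℂ (StarPoly R) where
  norm_smul_le r a := univNorm_le (mul_nonneg (norm_nonneg r) (univNorm_nonneg a))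
    fun B _ s v h => by
      rw [map_smul, norm_smul]
      exact mul_le_mul_of_nonneg_left (norm_eval_le h a) (norm_nonneg r)

instance : NormedStarGroup (StarPoly R) where
  norm_star_le a := univNorm_le (univNorm_nonneg a) fun B _ s v h => by
    rw [map_star, norm_star]
    exact norm_eval_le h a

theorem norm_mul_self_le (a : StarPoly R) : ‖a‖ * ‖a‖ ≤ ‖star a * a‖ := by
  have h : ‖a‖ ≤ √‖star a * a‖ := univNorm_le (Real.sqrt_nonneg _) fun B _ s v h => by
    refine Real.le_sqrt_of_sq_le ?_
    rw [sq, ← CStarRing.norm_star_mul_self, ← map_star, ← map_mul]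
    exact norm_eval_le h _
  calc ‖a‖ * ‖a‖ ≤ √‖star a * a‖ * √‖star a * a‖ :=
        mul_self_le_mul_self (norm_nonneg _) h
    _ = ‖star a * a‖ := Real.mul_self_sqrt (norm_nonneg _)

end StarPoly

end AxbAlgebra

/-! ### The universal C*-algebra -/

open UniformSpace AxbAlgebra

/-- `𝔄[R]`, the universal C*-algebra generated by isometries `s_m` and unitaries `u^n` subject to
the `ax+b` relations: the Hausdorff completion of the free *-algebra on these symbols in the
universal C*-seminorm. -/
def RingCStarAlgebra (R : Type u) [CommRing R] : Type u := Completion (StarPoly R)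

namespace RingCStarAlgebra

variable (R : Type u) [CommRing R]

instance : NormedRing (RingCStarAlgebra R) := inferInstanceAs (NormedRing (Completion (StarPoly R)))

instance : CompleteSpace (RingCStarAlgebra R) :=
  inferInstanceAs (CompleteSpace (Completion (StarPoly R)))

instance : Algebra ℂ (RingCStarAlgebra R) :=
  inferInstanceAs (Algebra ℂ (Completion (StarPoly R)))

instance : NormedAlgebra ℂ (RingCStarAlgebra R) where
  norm_smul_le r a := norm_smul_le (β := Completion (StarPoly R)) r a

variable {R}

/-- The canonical map from the free *-algebra. -/
def ofPoly (a : StarPoly R) : RingCStarAlgebra R := (a : Completion (StarPoly R))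

theorem induction {motive : RingCStarAlgebra R → Prop} (x : RingCStarAlgebra R)
    (closed : IsClosed {x | motive x}) (ofPoly : ∀ a : StarPoly R, motive (ofPoly a)) : motive x :=
  Completion.induction_on x closed ofPoly

theorem continuous_ofPoly : Continuous (ofPoly : StarPoly R → RingCStarAlgebra R) :=
  Completion.continuous_coe (StarPoly R)

theorem norm_ofPoly (a : StarPoly R) : ‖ofPoly a‖ = ‖a‖ := Completion.norm_coe a

theorem ofPoly_one : ofPoly (1 : StarPoly R) = 1 := rfl

theorem ofPoly_mul (a b : StarPoly R) : ofPoly (a * b) = ofPoly a * ofPoly b :=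
  Completion.coe_mul a b

theorem ofPoly_add (a b : StarPoly R) : ofPoly (a + b) = ofPoly a + ofPoly b :=
  Completion.coe_add a b

theorem ofPoly_smul (r : ℂ) (a : StarPoly R) : ofPoly (r • a) = r • ofPoly a :=
  Completion.coe_smul r a

theorem ofPoly_algebraMap (r : ℂ) :
    ofPoly (algebraMap ℂ (StarPoly R) r) = algebraMap ℂ (RingCStarAlgebra R) r := rfl

/-- The involution, extended by continuity. -/
def starFun (x : RingCStarAlgebra R) : RingCStarAlgebra R :=
  Completion.map (star : StarPoly R → StarPoly R) x

theorem starFun_ofPoly (a : StarPoly R) : starFun (ofPoly a) = ofPoly (star a) :=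
  Completion.map_coe star_isometry.uniformContinuous a

theorem continuous_starFun : Continuous (starFun : RingCStarAlgebra R → RingCStarAlgebra R) :=
  Completion.continuous_map

instance : StarRing (RingCStarAlgebra R) where
  star := starFun
  star_involutive x := by
    induction x using RingCStarAlgebra.induction with
    | closed => exact isClosed_eq (continuous_starFun.comp continuous_starFun) continuous_id
    | ofPoly a => rw [starFun_ofPoly, starFun_ofPoly, star_star]
  star_mul x y := by
    induction x using RingCStarAlgebra.induction with
    | closed =>
      exact isClosed_eq (continuous_starFun.comp (continuous_mul_const y))
        (continuous_const.mul continuous_starFun)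
    | ofPoly a =>
      induction y using RingCStarAlgebra.induction with
      | closed =>
        exact isClosed_eq (continuous_starFun.comp (continuous_const_mul _))
          (continuous_starFun.mul continuous_const)
      | ofPoly b =>
        rw [← ofPoly_mul, starFun_ofPoly, starFun_ofPoly, starFun_ofPoly, star_mul, ofPoly_mul]
  star_add x y := by
    induction x using RingCStarAlgebra.induction with
    | closed =>
      exact isClosed_eq (continuous_starFun.comp (continuous_add_const y))
        (continuous_starFun.add continuous_const)
    | ofPoly a =>
      induction y using RingCStarAlgebra.induction with
      | closed =>
        exact isClosed_eq (continuous_starFun.comp (continuous_const_add _))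
          (continuous_const.add continuous_starFun)
      | ofPoly b =>
        rw [← ofPoly_add, starFun_ofPoly, starFun_ofPoly, starFun_ofPoly, star_add, ofPoly_add]

theorem star_ofPoly (a : StarPoly R) : star (ofPoly a) = ofPoly (star a) := starFun_ofPoly a

instance : ContinuousStar (RingCStarAlgebra R) := ⟨continuous_starFun⟩

variable (R) in
instance : CStarAlgebra (RingCStarAlgebra R) where
  norm_mul_self_le x := by
    induction x using RingCStarAlgebra.induction with
    | closed =>
      exact isClosed_le (continuous_norm.mul continuous_norm)
        (continuous_norm.comp (continuous_star.mul continuous_id))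
    | ofPoly a =>
      rw [star_ofPoly, ← ofPoly_mul, norm_ofPoly, norm_ofPoly]
      exact StarPoly.norm_mul_self_le a
  star_smul r x := by
    induction x using RingCStarAlgebra.induction with
    | closed =>
      exact isClosed_eq (continuous_star.comp (continuous_const_smul r))
        ((continuous_const_smul (star r)).comp continuous_star)
    | ofPoly a => rw [← ofPoly_smul, star_ofPoly, star_ofPoly, star_smul, ofPoly_smul]

/-- The generating isometries `s_m`. -/
def s (m : R⁰) : RingCStarAlgebra R :=
  ofPoly (FreeStarAlgebra.gen (Sum.inl m) : FreeStarAlgebra (R⁰ ⊕ R))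

/-- The generating unitaries `u^n`. -/
def v (n : R) : RingCStarAlgebra R :=
  ofPoly (FreeStarAlgebra.gen (Sum.inr n) : FreeStarAlgebra (R⁰ ⊕ R))

/-- The canonical map from the free *-algebra as a *-homomorphism. -/
def ofPolyHom : StarPoly R →⋆ₐ[ℂ] RingCStarAlgebra R where
  toFun := ofPoly
  map_one' := rfl
  map_mul' := ofPoly_mul
  map_zero' := rfl
  map_add' := ofPoly_add
  commutes' := ofPoly_algebraMap
  map_star' a := (star_ofPoly a).symm

theorem ofPoly_eq_of_eval {a b : StarPoly R}
    (h : ∀ (B : Type u) (_ : CStarAlgebra B) (s : R⁰ → B) (v : R → B),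
      Relations s v → StarPoly.eval s v a = StarPoly.eval s v b) : ofPoly a = ofPoly b := by
  have h1 : ofPolyHom (a - b) = 0 := by
    refine norm_le_zero_iff.1 ?_
    change ‖ofPoly (a - b)‖ ≤ 0
    rw [norm_ofPoly]
    exact StarPoly.univNorm_le le_rfl fun B _ s v hr => by simp [h B _ s v hr]
  rw [map_sub, sub_eq_zero] at h1
  exact h1

theorem eval_gen_inl {B : Type*} [CStarAlgebra B] (s : R⁰ → B) (v : R → B) (m : R⁰) :
    StarPoly.eval s v (FreeStarAlgebra.gen (Sum.inl m) : FreeStarAlgebra (R⁰ ⊕ R)) = s m :=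
  FreeStarAlgebra.eval_gen _ _

theorem eval_gen_inr {B : Type*} [CStarAlgebra B] (s : R⁰ → B) (v : R → B) (n : R) :
    StarPoly.eval s v (FreeStarAlgebra.gen (Sum.inr n) : FreeStarAlgebra (R⁰ ⊕ R)) = v n :=
  FreeStarAlgebra.eval_gen _ _

/-- The generators satisfy the relations. -/
theorem relations : Relations (s : R⁰ → RingCStarAlgebra R) v := by
  have key : ∀ a b : StarPoly R, (∀ (B : Type u) (_ : CStarAlgebra B) (s : R⁰ → B) (v : R → B),
      Relations s v → StarPoly.eval s v a = StarPoly.eval s v b) → ofPolyHom a = ofPolyHom b :=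
    fun a b h => ofPoly_eq_of_eval h
  let S : R⁰ → StarPoly R := fun m => (FreeStarAlgebra.gen (Sum.inl m) : FreeStarAlgebra (R⁰ ⊕ R))
  let V : R → StarPoly R := fun n => (FreeStarAlgebra.gen (Sum.inr n) : FreeStarAlgebra (R⁰ ⊕ R))
  have hS : ∀ {B : Type u} [CStarAlgebra B] (s : R⁰ → B) (v : R → B) m,
      StarPoly.eval s v (S m) = s m := fun s v m => eval_gen_inl s v m
  have hV : ∀ {B : Type u} [CStarAlgebra B] (s : R⁰ → B) (v : R → B) n,
      StarPoly.eval s v (V n) = v n := fun s v n => eval_gen_inr s v n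
  have hs : ∀ m, (s m : RingCStarAlgebra R) = ofPolyHom (S m) := fun _ => rfl
  have hv : ∀ n, (v n : RingCStarAlgebra R) = ofPolyHom (V n) := fun _ => rfl
  refine ⟨fun m => ?_, fun n => Unitary.mem_iff.2 ⟨?_, ?_⟩, fun k m => ?_, fun l n => ?_,
    fun m n => ?_, fun m T hT => ?_⟩
  · rw [hs, ← map_star, ← map_mul, ← map_one ofPolyHom]
    exact key _ _ fun B _ s v h => by simp only [map_mul, map_star, map_one, hS, h.isometry]
  · rw [hv, ← map_star, ← map_mul, ← map_one ofPolyHom]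
    exact key _ _ fun B _ s v h => by
      simp only [map_mul, map_star, map_one, hV, Unitary.star_mul_self_of_mem (h.unitary n)]
  · rw [hv, ← map_star, ← map_mul, ← map_one ofPolyHom]
    exact key _ _ fun B _ s v h => by
      simp only [map_mul, map_star, map_one, hV, Unitary.mul_star_self_of_mem (h.unitary n)]
  · rw [hs, hs, hs, ← map_mul]
    exact key _ _ fun B _ s v h => by simp only [map_mul, hS, h.s_mul]
  · rw [hv, hv, hv, ← map_mul]
    exact key _ _ fun B _ s v h => by simp only [map_mul, hV, h.v_add]
  · rw [hs, hv, hv, ← map_mul, ← map_mul]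
    exact key _ _ fun B _ s v h => by simp only [map_mul, hS, hV, h.s_v]
  · simp only [hs, hv, ← map_mul, ← map_star, ← map_sum]
    rw [← map_one ofPolyHom]
    exact key _ _ fun B _ s v h => by
      simp only [map_sum, map_mul, map_star, map_one, hS, hV, h.sum_cosets m T hT]

/-- The universal property: every family that satisfies the relations in a unital C*-algebra is
the image of the generators under exactly one unital *-homomorphism. -/
theorem existsUnique_hom {B : Type u} [CStarAlgebra B] {s' : R⁰ → B} {v' : R → B}
    (h : Relations s' v') :
    ∃! φ : RingCStarAlgebra R →⋆ₐ[ℂ] B, (∀ m, φ (s m) = s' m) ∧ ∀ n, φ (v n) = v' n := by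
  have hcont : UniformContinuous (StarPoly.eval s' v') :=
    AddMonoidHomClass.uniformContinuous_of_bound (StarPoly.eval s' v') 1 fun a => by
      rw [one_mul]
      exact StarPoly.norm_eval_le h a
  obtain ⟨φ, hφc, hφ⟩ : ∃ φ : RingCStarAlgebra R → B, Continuous φ ∧
      ∀ a, φ (ofPoly a) = StarPoly.eval s' v' a :=
    ⟨Completion.extension (StarPoly.eval s' v'), Completion.continuous_extension,
      Completion.extension_coe hcont⟩
  refine ⟨{ toFun := φ, map_one' := ?_, map_mul' := ?_, map_zero' := ?_, map_add' := ?_,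
            commutes' := ?_, map_star' := ?_ }, ⟨?_, ?_⟩, ?_⟩
  · rw [← ofPoly_one, hφ, map_one]
  · intro x y
    induction x using RingCStarAlgebra.induction with
    | closed => exact isClosed_eq (hφc.comp (continuous_mul_const y)) (hφc.mul continuous_const)
    | ofPoly a =>
      induction y using RingCStarAlgebra.induction with
      | closed => exact isClosed_eq (hφc.comp (continuous_const_mul _)) (continuous_const.mul hφc)
      | ofPoly b => rw [← ofPoly_mul, hφ, hφ, hφ, map_mul]
  · exact (hφ 0).trans (map_zero _)
  · intro x y
    induction x using RingCStarAlgebra.induction with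
    | closed => exact isClosed_eq (hφc.comp (continuous_add_const y)) (hφc.add continuous_const)
    | ofPoly a =>
      induction y using RingCStarAlgebra.induction with
      | closed => exact isClosed_eq (hφc.comp (continuous_const_add _)) (continuous_const.add hφc)
      | ofPoly b => rw [← ofPoly_add, hφ, hφ, hφ, map_add]
  · intro r
    exact (hφ _).trans (AlgHomClass.commutes _ r)
  · intro x
    induction x using RingCStarAlgebra.induction with
    | closed => exact isClosed_eq (hφc.comp continuous_star) (continuous_star.comp hφc)
    | ofPoly a => rw [star_ofPoly, hφ, hφ, map_star]
  · exact fun m => (hφ _).trans (eval_gen_inl _ _ m)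
  · exact fun n => (hφ _).trans (eval_gen_inr _ _ n)
  · rintro ψ ⟨hψs, hψv⟩
    refine StarAlgHom.ext fun x => ?_
    change ψ x = φ x
    have hψc : Continuous ψ :=
      AddMonoidHomClass.continuous_of_bound ψ 1 fun x => by
        rw [one_mul]
        exact NonUnitalStarAlgHom.norm_apply_le ψ x
    refine induction (motive := fun x => ψ x = φ x) x (isClosed_eq hψc hφc) fun a => ?_
    rw [hφ]
    change ψ (ofPolyHom a) = _
    induction a using FreeStarAlgebra.induction with
    | scalar r =>
      exact (AlgHomClass.commutes (ψ.comp ofPolyHom) r).trans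
        (AlgHomClass.commutes (StarPoly.eval s' v') r).symm
    | sym x =>
      have hgen : ∀ y : R⁰ ⊕ R, ψ (ofPolyHom (FreeStarAlgebra.sym (y, false) : StarPoly R)) =
          Sum.elim s' v' y := by
        rintro (m | n)
        · exact hψs m
        · exact hψv n
      have he : StarPoly.eval s' v' (FreeStarAlgebra.sym x) =
        if x.2 then star (Sum.elim s' v' x.1) else Sum.elim s' v' x.1 :=
          FreeStarAlgebra.eval_sym _ x
      rw [he]
      rcases x with ⟨y, _ | _⟩
      · exact hgen y
      · have : (FreeStarAlgebra.sym (y, true) : StarPoly R) =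
            star (FreeStarAlgebra.sym (y, false) : StarPoly R) :=
          (FreeStarAlgebra.star_sym (y, false)).symm
        erw [this, map_star, map_star, hgen]
        rfl
    | mul a b ha hb =>
      exact (map_mul (ψ.comp ofPolyHom) a b).trans
        ((congrArg₂ (· * ·) ha hb).trans (map_mul (StarPoly.eval s' v') a b).symm)
    | add a b ha hb =>
      exact (map_add (ψ.comp ofPolyHom) a b).trans
        ((congrArg₂ (· + ·) ha hb).trans (map_add (StarPoly.eval s' v') a b).symm)

end RingCStarAlgebra

/-! ### Simple and purely infinite C*-algebras -/

/-- A C*-algebra is simple if it is nonzero and its only closed two-sided ideals are the trivial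
ones. -/
def IsSimpleCStarAlgebra (A : Type*) [CStarAlgebra A] : Prop :=
  Nontrivial A ∧ ∀ I : TwoSidedIdeal A, IsClosed (I : Set A) → I = ⊥ ∨ I = ⊤

/-- Pure infiniteness of a (simple) unital C*-algebra: for every `x ≠ 0` there are `a`, `b` with
`a x b = 1`. The algebra `ℂ`, which has this property, is not purely infinite by convention. -/
def IsPurelyInfiniteCStarAlgebra (A : Type*) [CStarAlgebra A] : Prop :=
  IsEmpty (A ≃⋆ₐ[ℂ] ℂ) ∧ ∀ x : A, x ≠ 0 → ∃ a b : A, a * x * b = 1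

end

/-! The products `u^a s_k (u^b s_l)^*`, which implement the partial affine bijections
`b + lx ↦ a + kx`, span a dense *-subalgebra of `𝔄[R]`. They act on `ℓ²(R × K^×)`, where `K` is the
fraction field of `R` and the second coordinate is multiplied by `k / l`.

This regular representation `ρ` is isometric. The span is graded by `k / l ∈ K^×`, and its component
of degree `1` is an increasing union of algebras graded by the translation part in `R`. In both
gradings the norm of a component of `y` is at most a constant times `‖ρ y‖`. Abelian groups have
polynomial growth, so `‖y ^ p‖ ≤ f(p) ‖ρ y‖ ^ p` with a polynomial `f` for self-adjoint `y`, and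
taking `p`-th roots along `p = 2 ^ j` gives `‖y‖ ≤ ‖ρ y‖`.

For `x ≠ 0` there is thus a basis vector `e` at some `(r, g)` with `⟨e, ρ(x^* x) e⟩ ≠ 0`. Take `c`
near `r` in the ideal topology that is fixed by none of the finitely many partial bijections in a
finite combination `z`, except for identities. If `m` does not divide the displacements of `c`, then
`w = u^c s_(Nm)`, for a suitable `N`, satisfies `w^* z w = ⟨e, ρ(z) e⟩`. When `z` is close enough to
`x^* x`, this makes `w^* x^* x w` invertible. -/

namespace AxbAlgebra

/-! ### Norm comparison from polynomial growth -/

section Growth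

open Filter
open scoped Pointwise

theorem card_pow_le_succ_pow_card {M : Type*} [CommMonoid M] [DecidableEq M] (S : Finset M)
    (p : ℕ) : (S ^ p).card ≤ (p + 1) ^ S.card := by
  have exponents : S ^ p ⊆ (Fintype.piFinset fun _ : S => Finset.range (p + 1)).image
      fun e => ∏ x : S, (x : M) ^ e x := by
    intro x hx
    obtain ⟨f, rfl⟩ := Finset.mem_pow.1 hx
    refine Finset.mem_image.2 ⟨fun y => Fintype.card {i // f i = y}, ?_, ?_⟩
    · simpa [Nat.lt_succ_iff] using fun y hy => Fintype.card_subtype_le fun i => f i = ⟨y, hy⟩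
    · rw [List.prod_ofFn, ← Fintype.prod_fiberwise' f fun y => (y : M)]
      simp only [Finset.prod_const, Finset.card_univ]
  calc (S ^ p).card
      ≤ (Fintype.piFinset fun _ : S => Finset.range (p + 1)).card :=
        (Finset.card_le_card exponents).trans Finset.card_image_le
    _ = (p + 1) ^ S.card := by simp

theorem le_of_frequently_pow_le {a b C : ℝ} (hb : 0 ≤ b) (d : ℕ)
    (h : ∃ᶠ p : ℕ in atTop, a ^ p ≤ C * (p + 1) ^ d * b ^ p) : a ≤ b := by
  by_contra! hlt
  obtain ⟨c, hbc, hca⟩ := exists_between hlt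
  have hc : 0 < c := hb.trans_lt hbc
  have ha : 0 < a := hc.trans hca
  have tendsto_zero : Tendsto (fun p : ℕ => |C| * ((p + 1) ^ d / (a / c) ^ p)) atTop (nhds 0) := by
    have := ((tendsto_pow_const_div_const_pow_of_one_lt d ((one_lt_div hc).2 hca)).comp
      (tendsto_add_atTop_nat 1)).const_mul (|C| * (a / c))
    refine (mul_zero (|C| * (a / c)) ▸ this).congr fun p => ?_
    simp only [Function.comp_apply, pow_succ (a / c), Nat.cast_add, Nat.cast_one]
    field_simp
  refine h ((tendsto_zero.eventually_lt_const one_pos).mono fun p hp => ?_)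
  rw [div_pow, div_div_eq_mul_div, ← mul_div_assoc, div_lt_one (by positivity), ← mul_assoc] at hp
  refine not_le.2 (lt_of_le_of_lt ?_ hp)
  gcongr
  exact le_abs_self C

theorem norm_le_of_norm_pow_le {A : Type*} [NormedRing A] [StarRing A] [CStarRing A] {y : A}
    (hy : IsSelfAdjoint y) {b C : ℝ} (hb : 0 ≤ b) (d : ℕ)
    (h : ∀ p : ℕ, p ≠ 0 → ‖y ^ p‖ ≤ C * (p + 1) ^ d * b ^ p) : ‖y‖ ≤ b := by
  have two_pow : ∀ k : ℕ, ‖y‖ ^ 2 ^ k ≤ C * ((2 ^ k : ℕ) + 1) ^ d * b ^ 2 ^ k := fun k => by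
    simpa only [hy.norm_pow_two_pow] using h (2 ^ k) (by positivity)
  exact le_of_frequently_pow_le hb d
    ((tendsto_pow_atTop_atTop_of_one_lt one_lt_two).frequently (Frequently.of_forall two_pow))

section Semiring

variable {G 𝕜 A : Type*} [CommMonoid G] [DecidableEq G] [CommSemiring 𝕜] [Semiring A]
  [Algebra 𝕜 A] {V : G → Submodule 𝕜 A}

theorem sup_mul_sup_le (hV : ∀ g h, V g * V h ≤ V (g * h)) (S T : Finset G) :
    S.sup V * T.sup V ≤ (S * T).sup V := by
  simp only [Finset.sup_eq_iSup S, Finset.sup_eq_iSup T, Submodule.iSup_mul, Submodule.mul_iSup,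
    iSup_le_iff]
  exact fun h hh g hg => (hV g h).trans (Finset.le_sup (Finset.mul_mem_mul hg hh))

theorem sup_pow_le (hV : ∀ g h, V g * V h ≤ V (g * h)) (S : Finset G) {p : ℕ} (hp : p ≠ 0) :
    S.sup V ^ p ≤ (S ^ p).sup V := by
  induction p, Nat.one_le_iff_ne_zero.2 hp using Nat.le_induction with
  | base => simp only [pow_one, le_refl]
  | succ p hp' ih =>
    rw [pow_succ, pow_succ]
    exact (mul_le_mul_left (ih (Nat.one_le_iff_ne_zero.1 hp')) _).trans
      (sup_mul_sup_le hV _ _)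

end Semiring

variable {G A B : Type*} [CStarAlgebra A] [CStarAlgebra B] {V : G → Submodule ℂ A}
  {ρ : A →⋆ₐ[ℂ] B} {C : ℝ}

theorem norm_le_card_mul_norm_map
    (hC : ∀ (S : Finset G) (x : G → A), (∀ g, x g ∈ V g) → ∀ g ∈ S, ‖x g‖ ≤ C * ‖ρ (∑ g ∈ S, x g)‖)
    {S : Finset G} {x : A} (hx : x ∈ S.sup V) : ‖x‖ ≤ C * S.card * ‖ρ x‖ := by
  rw [Finset.sup_eq_iSup, Submodule.mem_iSup_finset_iff_exists_sum] at hx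
  obtain ⟨a, rfl⟩ := hx
  calc ‖∑ g ∈ S, (a g : A)‖
      ≤ ∑ g ∈ S, ‖(a g : A)‖ := norm_sum_le _ _
    _ ≤ S.card • (C * ‖ρ (∑ g ∈ S, (a g : A))‖) :=
        Finset.sum_le_card_nsmul _ _ _ (hC S _ fun g => (a g).2)
    _ = C * S.card * ‖ρ (∑ g ∈ S, (a g : A))‖ := by rw [nsmul_eq_mul]; ring

/- The powers of `star y * y` have only polynomially many components, so a norm estimate for the
components controls them up to a polynomial factor, which disappears on taking roots. -/
theorem norm_le_norm_map_of_graded [CommMonoid G] (hV : ∀ g h, V g * V h ≤ V (g * h)) (hC₀ : 0 ≤ C)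
    (hC : ∀ (S : Finset G) (x : G → A), (∀ g, x g ∈ V g) → ∀ g ∈ S, ‖x g‖ ≤ C * ‖ρ (∑ g ∈ S, x g)‖)
    {y : A} (hy : star y * y ∈ ⨆ g, V g) : ‖y‖ ≤ ‖ρ y‖ := by
  classical
  obtain ⟨S, hS⟩ := Submodule.mem_iSup_iff_exists_finset.1 hy
  rw [← Finset.sup_eq_iSup] at hS
  suffices ‖star y * y‖ ≤ ‖ρ (star y * y)‖ by
    rw [map_mul, map_star, CStarRing.norm_star_mul_self, CStarRing.norm_star_mul_self] at this
    exact le_of_sq_le_sq (by simpa only [sq] using this) (norm_nonneg _)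
  refine norm_le_of_norm_pow_le (C := C) (IsSelfAdjoint.star_mul_self y) (norm_nonneg _) S.card
    fun p hp => ?_
  calc ‖(star y * y) ^ p‖
      ≤ C * (S ^ p).card * ‖ρ ((star y * y) ^ p)‖ :=
        norm_le_card_mul_norm_map hC (sup_pow_le hV S hp (Submodule.pow_mem_pow _ hS p))
    _ ≤ C * (p + 1) ^ S.card * ‖ρ (star y * y)‖ ^ p := by
        rw [map_pow]
        gcongr
        · exact_mod_cast card_pow_le_succ_pow_card S p
        · exact norm_pow_le' _ (Nat.pos_of_ne_zero hp)

end Growth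

end AxbAlgebra

section CStarAlgebra

variable {A : Type*} [CStarAlgebra A]

theorem AxbAlgebra.eq_zero_of_sum_mul_star_self_eq_zero {ι : Type*} {T : Finset ι} {x : ι → A}
    (h : ∑ t ∈ T, x t * star (x t) = 0) {t : ι} (ht : t ∈ T) : x t = 0 := by
  let _ := CStarAlgebra.spectralOrder A
  have _ := CStarAlgebra.spectralOrderedRing A
  exact CStarRing.mul_star_self_eq_zero_iff _ |>.1
    ((Finset.sum_eq_zero_iff_of_nonneg fun t _ => mul_star_self_nonneg (x t)).1 h t ht)

theorem AxbAlgebra.exists_mul_mul_eq_one_of_dense {M : Set A} (hM : Dense M) {φ : A → ℂ}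
    (hφ : Continuous φ)
    (compress : ∀ z ∈ M, ∃ w, star w * w = 1 ∧ star w * z * w = φ z • (1 : A))
    {y : A} (hy : φ y ≠ 0) : ∃ a b, a * y * b = 1 := by
  obtain ⟨z, hzy, hzM⟩ : ∃ z, ‖z - y‖ < ‖φ z‖ ∧ z ∈ M :=
    hM.inter_open_nonempty {z | ‖z - y‖ < ‖φ z‖} (isOpen_lt (by fun_prop) (by fun_prop))
      ⟨y, by simpa using hy⟩
  have hz : φ z ≠ 0 := norm_pos_iff.1 ((norm_nonneg _).trans_lt hzy)
  obtain ⟨w, hw, hwz⟩ := compress z hzM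
  have hw_norm : ‖w‖ ≤ 1 := AxbAlgebra.StarPoly.norm_le_one_of_isometry hw
  have compress_y : (φ z)⁻¹ • (star w * y * w) = 1 - (φ z)⁻¹ • (star w * (z - y) * w) := by
    rw [mul_sub, sub_mul, hwz, smul_sub, inv_smul_smul₀ hz, sub_sub_cancel]
  have error_lt : ‖star w * (z - y) * w‖ < ‖φ z‖ :=
    calc ‖star w * (z - y) * w‖
        ≤ ‖star w‖ * ‖z - y‖ * ‖w‖ := norm_mul₃_le
      _ ≤ 1 * ‖z - y‖ * 1 := by gcongr; rwa [norm_star]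
      _ < ‖φ z‖ := by rwa [one_mul, mul_one]
  have isUnit : IsUnit ((φ z)⁻¹ • (star w * y * w)) := by
    rw [compress_y]
    refine isUnit_one_sub_of_norm_lt_one ?_
    rwa [norm_smul, norm_inv, inv_mul_lt_iff₀ (norm_pos_iff.2 hz), mul_one]
  obtain ⟨a, ha⟩ := isUnit.exists_left_inv
  refine ⟨a * (φ z)⁻¹ • star w, w, ?_⟩
  rw [← ha]
  simp only [mul_smul_comm, smul_mul_assoc, mul_assoc]

theorem IsPurelyInfiniteCStarAlgebra.isSimple [Nontrivial A]
    (h : IsPurelyInfiniteCStarAlgebra A) : IsSimpleCStarAlgebra A := by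
  refine ⟨inferInstance, fun I _ => ?_⟩
  by_cases hI : ∃ x ∈ I, x ≠ 0
  · obtain ⟨x, hxI, hx⟩ := hI
    obtain ⟨a, b, hab⟩ := h.2 x hx
    exact Or.inr (I.one_mem_iff.1 (hab ▸ I.mul_mem_right _ _ (I.mul_mem_left _ _ hxI)))
  · push Not at hI
    exact Or.inl (eq_bot_iff.2 hI)

theorem AxbAlgebra.isEmpty_starAlgEquiv_complex_of_not_commute {x y : A} (h : ¬ Commute x y) :
    IsEmpty (A ≃⋆ₐ[ℂ] ℂ) :=
  ⟨fun φ => h (φ.injective (by rw [map_mul, map_mul, mul_comm]))⟩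

end CStarAlgebra

namespace AxbAlgebra

/-! ### Residues -/

section Representatives

variable {R : Type*} [CommRing R]

theorem hasFiniteQuotients_of_finite_quotient_span_singleton
    (h : ∀ m : R, m ≠ 0 → Finite (R ⧸ Ideal.span {m})) : Ring.HasFiniteQuotients R where
  finiteQuotient {I} hI := by
    obtain ⟨m, hm, hm0⟩ := Submodule.exists_mem_ne_zero_of_ne_bot hI
    have := h m hm0
    exact Finite.of_surjective _
      (Ideal.Quotient.factor_surjective ((Ideal.span_singleton_le_iff_mem I).2 hm))

theorem finite_quotient_span_singleton [Ring.HasFiniteQuotients R] (m : R⁰) :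
    Finite (R ⧸ Ideal.span {(m : R)}) := by
  nontriviality R
  exact Ring.HasFiniteQuotients.finiteQuotient
    (mt Ideal.span_singleton_eq_bot.1 (nonZeroDivisors.coe_ne_zero m))

theorem exists_representatives_superset [Ring.HasFiniteQuotients R] (m : R⁰) {S : Set R}
    (hS : S.InjOn (Ideal.Quotient.mk (Ideal.span {(m : R)}))) :
    ∃ T : Finset R, S ⊆ T ∧
      Set.BijOn (Ideal.Quotient.mk (Ideal.span {(m : R)})) (T : Set R) Set.univ := by
  have := finite_quotient_span_singleton m
  obtain ⟨T, hST, hT⟩ := hS.bijOn_image.exists_extend (Set.subset_univ _)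
    (Ideal.Quotient.mk_surjective (I := Ideal.span {(m : R)})).range_eq.ge
  exact ⟨(hT.finite_iff_finite.2 Set.finite_univ).toFinset, by simpa using hST, by simpa using hT⟩

theorem exists_representatives [Ring.HasFiniteQuotients R] (m : R⁰) : ∃ T : Finset R,
    Set.BijOn (Ideal.Quotient.mk (Ideal.span {(m : R)})) (T : Set R) Set.univ :=
  (exists_representatives_superset m (Set.injOn_empty _)).imp fun _ h => h.2

variable {m : R} {T : Finset R}

theorem exists_eq_add_mul_of_bijOn
    (hT : Set.BijOn (Ideal.Quotient.mk (Ideal.span {m})) (T : Set R) Set.univ) (n : R) :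
    ∃ t ∈ T, ∃ q, n = t + m * q := by
  obtain ⟨t, ht, htn⟩ := hT.surjOn (Set.mem_univ (Ideal.Quotient.mk _ n))
  obtain ⟨q, hq⟩ := Ideal.mem_span_singleton.1 (Ideal.Quotient.eq.1 htn.symm)
  exact ⟨t, ht, q, by rw [← hq, add_sub_cancel]⟩

theorem eq_of_dvd_sub_of_bijOn
    (hT : Set.BijOn (Ideal.Quotient.mk (Ideal.span {m})) (T : Set R) Set.univ) {t u : R}
    (ht : t ∈ T) (hu : u ∈ T) (h : m ∣ t - u) : t = u :=
  hT.injOn ht hu (Ideal.Quotient.eq.2 (Ideal.mem_span_singleton.2 h))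

end Representatives

/-! ### Products of the affine isometries -/

/-- The isometry `u^a s_k` attached to the affine map `x ↦ a + kx`. The products
`u^a s_k (u^b s_l)^*` then implement the partial affine bijections `b + lx ↦ a + kx`. -/
def affine {R : Type*} [CommRing R] {B : Type*} [Ring B] (s : R⁰ → B) (v : R → B) (a : R)
    (k : R⁰) : B :=
  v a * s k

namespace Relations

variable {R : Type*} [CommRing R] {B : Type*} [CStarAlgebra B] {s : R⁰ → B} {v : R → B}

theorem v_zero (h : Relations s v) : v 0 = 1 := by
  have idem : star (v 0) * (v 0 * v 0) = star (v 0) * v 0 := by rw [h.v_add, add_zero]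
  rwa [← mul_assoc, Unitary.star_mul_self_of_mem (h.unitary 0), one_mul] at idem

theorem s_one (h : Relations s v) : s 1 = 1 := by
  have idem : star (s 1) * (s 1 * s 1) = star (s 1) * s 1 := by rw [h.s_mul, one_mul]
  rwa [← mul_assoc, h.isometry, one_mul] at idem

theorem star_v (h : Relations s v) (n : R) : star (v n) = v (-n) := by
  rw [← mul_one (star (v n)), ← h.v_zero, ← add_neg_cancel n, ← h.v_add, ← mul_assoc,
    Unitary.star_mul_self_of_mem (h.unitary n), one_mul]

theorem affine_zero (h : Relations s v) (k : R⁰) : affine s v 0 k = s k := by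
  rw [affine, h.v_zero, one_mul]

theorem affine_one (h : Relations s v) (a : R) : affine s v a 1 = v a := by
  rw [affine, h.s_one, mul_one]

theorem affine_mul_affine (h : Relations s v) (a b : R) (k l : R⁰) :
    affine s v a k * affine s v b l = affine s v (a + k * b) (k * l) := by
  simp only [affine, ← h.v_add, ← h.s_mul, mul_assoc]
  rw [← mul_assoc (s k), h.s_v, mul_assoc]

theorem star_affine_mul_self (h : Relations s v) (a : R) (k : R⁰) :
    star (affine s v a k) * affine s v a k = 1 := by
  rw [affine, star_mul, mul_assoc, ← mul_assoc (star (v a)),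
    Unitary.star_mul_self_of_mem (h.unitary a), one_mul, h.isometry]

theorem norm_affine_le_one (h : Relations s v) (a : R) (k : R⁰) : ‖affine s v a k‖ ≤ 1 :=
  StarPoly.norm_le_one_of_isometry (h.star_affine_mul_self a k)

theorem norm_affine_mul_star_affine_le_one (h : Relations s v) (a b : R) (k l : R⁰) :
    ‖affine s v a k * star (affine s v b l)‖ ≤ 1 := by
  refine (norm_mul_le _ _).trans (mul_le_one₀ (h.norm_affine_le_one a k) (norm_nonneg _) ?_)
  rw [norm_star]
  exact h.norm_affine_le_one b l

theorem sum_affine_mul_star_affine (h : Relations s v) {m : R⁰} {T : Finset R}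
    (hT : Set.BijOn (Ideal.Quotient.mk (Ideal.span {(m : R)})) (T : Set R) Set.univ) :
    ∑ t ∈ T, affine s v t m * star (affine s v t m) = 1 := by
  rw [← h.sum_cosets m T hT]
  simp only [affine, star_mul, h.star_v, mul_assoc]

theorem affine_add_mul_star_affine_add (h : Relations s v) (a b q : R) (k l : R⁰) :
    affine s v (a + k * q) k * star (affine s v (b + l * q) l) =
      affine s v a k * star (affine s v b l) := by
  have translate : ∀ c (n : R⁰), affine s v (c + n * q) n = affine s v c n * v q := fun c n => by
    rw [← h.affine_one q, h.affine_mul_affine, mul_one]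
  rw [translate, translate, star_mul, mul_assoc, ← mul_assoc (v q),
    Unitary.mul_star_self_of_mem (h.unitary q), one_mul]

theorem affine_mul_star_affine_eq_sum (h : Relations s v) (a b : R) (k l : R⁰) {m : R⁰}
    {T : Finset R}
    (hT : Set.BijOn (Ideal.Quotient.mk (Ideal.span {(m : R)})) (T : Set R) Set.univ) :
    affine s v a k * star (affine s v b l) =
      ∑ t ∈ T, affine s v (a + k * t) (k * m) * star (affine s v (b + l * t) (l * m)) := by
  simp only [← h.affine_mul_affine, star_mul, mul_assoc]
  simp only [← mul_assoc (affine s v _ m), ← Finset.mul_sum, ← Finset.sum_mul,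
    h.sum_affine_mul_star_affine hT, one_mul]

theorem star_affine_mul_affine_add (h : Relations s v) (b q : R) (l m : R⁰) :
    star (affine s v b l) * affine s v (b + l * q) (l * m) = affine s v q m := by
  rw [← h.affine_mul_affine, ← mul_assoc, h.star_affine_mul_self, one_mul]

variable [Ring.HasFiniteQuotients R]

/- `1` and `u^n` are two distinct terms of a coset sum, compressed by `s_m`; since the term of `1`
is already everything, the other one vanishes. -/
theorem star_s_mul_v_mul_s_eq_zero (h : Relations s v) {m : R⁰} {n : R} (hn : ¬ (m : R) ∣ n) :
    star (s m) * v n * s m = 0 := by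
  classical
  have inj : Set.InjOn (Ideal.Quotient.mk (Ideal.span {(m : R)})) {0, n} :=
    Set.injOn_pair.2 fun h0 => absurd (Ideal.mem_span_singleton.1
      (Ideal.Quotient.eq_zero_iff_mem.1 (h0.symm.trans (map_zero _)))) hn
  obtain ⟨T, hST, hT⟩ := exists_representatives_superset m inj
  have h0T : 0 ∈ T := hST (Set.mem_insert _ _)
  have hnT : n ∈ T := hST (Set.mem_insert_of_mem _ rfl)
  have hn0 : n ≠ 0 := fun h0 => hn (h0 ▸ dvd_zero _)
  have sum_eq_one : ∑ t ∈ T, star (s m) * affine s v t m * star (star (s m) * affine s v t m) = 1 :=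
    calc _ = star (s m) * (∑ t ∈ T, affine s v t m * star (affine s v t m)) * s m := by
          simp only [star_mul, star_star, Finset.mul_sum, Finset.sum_mul, mul_assoc]
      _ = 1 := by rw [h.sum_affine_mul_star_affine hT, mul_one, h.isometry]
  rw [← Finset.add_sum_erase T _ h0T, h.affine_zero, h.isometry, star_one, mul_one,
    add_eq_left] at sum_eq_one
  rw [mul_assoc]
  exact eq_zero_of_sum_mul_star_self_eq_zero sum_eq_one (Finset.mem_erase.2 ⟨hn0, hnT⟩)

theorem star_affine_mul_affine_eq_zero (h : Relations s v) {m : R⁰} (l n : R⁰) {b c : R}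
    (hbc : ¬ (m : R) ∣ c - b) : star (affine s v b (m * l)) * affine s v c (m * n) = 0 := by
  have factor : star (affine s v b (m * l)) * affine s v c (m * n) =
      star (s l) * (star (s m) * v (c - b) * s m) * s n := by
    simp only [affine, star_mul, ← h.s_mul, h.star_v, sub_eq_neg_add, ← h.v_add, mul_assoc]
  rw [factor, h.star_s_mul_v_mul_s_eq_zero hbc, mul_zero, zero_mul]

theorem affine_mul_star_affine_mul_mem (h : Relations s v) {W : Submodule ℂ B} (a b c d : R)
    (k l m n : R⁰)
    (hW : ∀ a' d', affine s v a' (k * m) * star (affine s v d' (l * n)) ∈ W) :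
    affine s v a k * star (affine s v b l) * (affine s v c m * star (affine s v d n)) ∈ W := by
  obtain ⟨T, hT⟩ := exists_representatives l
  rw [h.affine_mul_star_affine_eq_sum c d m n hT, Finset.mul_sum]
  refine sum_mem fun t _ => ?_
  rw [mul_assoc, ← mul_assoc (star _), mul_comm m l, mul_comm n l]
  by_cases hl : (l : R) ∣ c + m * t - b
  · obtain ⟨q, hq⟩ := hl
    rw [eq_add_of_sub_eq' hq, h.star_affine_mul_affine_add, ← mul_assoc, h.affine_mul_affine]
    exact hW _ _
  · have orthogonal := h.star_affine_mul_affine_eq_zero 1 m hl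
    rw [mul_one] at orthogonal
    rw [orthogonal, zero_mul, mul_zero]
    exact zero_mem W

theorem not_commute_s_v [Nontrivial B] (h : Relations s v) {m : R⁰} {n : R}
    (hn : ¬ (m : R) ∣ n) : ¬ Commute (s m) (v n) := fun comm => by
  have v_eq_zero := h.star_s_mul_v_mul_s_eq_zero hn
  rw [mul_assoc, ← comm.eq, ← mul_assoc, h.isometry, one_mul] at v_eq_zero
  simpa [v_eq_zero] using Unitary.star_mul_self_of_mem (h.unitary n)

end Relations

/-! ### The regular representations -/

noncomputable section

open ContinuousLinearMap (adjoint)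
open scoped lp InnerProductSpace

section Push

variable {ι κ : Type*}

open Classical in
/-- The standard basis vectors of `ℓ²(ι)`. -/
def basisVec (i : ι) : ℓ²(ι, ℂ) := lp.single 2 i (1 : ℂ)

theorem inner_basisVec (i j : ι) [Decidable (i = j)] :
    ⟪basisVec i, basisVec j⟫_ℂ = if i = j then 1 else 0 := by
  classical
  rw [basisVec, basisVec, lp.inner_single_left, lp.single_apply, Pi.single_apply]
  simp

theorem orthonormal_basisVec : Orthonormal ℂ (basisVec : ι → ℓ²(ι, ℂ)) := by
  classical exact orthonormal_iff_ite.2 fun i j => inner_basisVec i j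

theorem norm_basisVec (i : ι) : ‖basisVec i‖ = 1 := orthonormal_basisVec.norm_eq_one i

theorem ext_basisVec {E : Type*} [NormedAddCommGroup E] [NormedSpace ℂ E]
    {S T : ℓ²(ι, ℂ) →L[ℂ] E} (h : ∀ i, S (basisVec i) = T (basisVec i)) : S = T := by
  classical
  refine lp.ext_continuousLinearMap (by norm_num) fun i => ?_
  ext
  exact h i

theorem ext_inner_basisVec {x y : ℓ²(ι, ℂ)} (h : ∀ i, ⟪basisVec i, x⟫_ℂ = ⟪basisVec i, y⟫_ℂ) :
    x = y := by
  classical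
  ext i
  simpa [basisVec, lp.inner_single_left] using h i

/-- The isometry `ℓ²(ι) → ℓ²(κ)` that maps the basis vector at `i` to the one at `f i`, as a
continuous linear map. -/
def push (f : ι → κ) (hf : f.Injective) : ℓ²(ι, ℂ) →L[ℂ] ℓ²(κ, ℂ) :=
  (orthonormal_basisVec.comp f hf).orthogonalFamily.linearIsometry.toContinuousLinearMap

variable (f : ι → κ) (hf : f.Injective)

theorem push_basisVec (i : ι) : push f hf (basisVec i) = basisVec (f i) := by
  classical
  change (orthonormal_basisVec.comp f hf).orthogonalFamily.linearIsometry (lp.single 2 i 1) = _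
  rw [OrthogonalFamily.linearIsometry_apply_single]
  simp

theorem norm_push_le_one : ‖push f hf‖ ≤ 1 :=
  LinearIsometry.norm_toContinuousLinearMap_le _

theorem adjoint_push_basisVec (i : ι) : adjoint (push f hf) (basisVec (f i)) = basisVec i := by
  classical
  refine ext_inner_basisVec fun j => ?_
  rw [ContinuousLinearMap.adjoint_inner_right, push_basisVec, inner_basisVec, inner_basisVec]
  simp only [hf.eq_iff]

theorem adjoint_push_basisVec_of_notMem {j : κ} (hj : j ∉ Set.range f) :
    adjoint (push f hf) (basisVec j) = 0 := by
  classical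
  refine ext_inner_basisVec fun i => ?_
  rw [ContinuousLinearMap.adjoint_inner_right, push_basisVec, inner_basisVec,
    if_neg fun hij => hj ⟨i, hij⟩, inner_zero_right]

theorem adjoint_push_comp_push : adjoint (push f hf) ∘L push f hf = .id ℂ _ :=
  ext_basisVec fun i => by
    rw [ContinuousLinearMap.comp_apply, push_basisVec, adjoint_push_basisVec]; rfl

end Push

variable {R : Type*} [CommRing R] [IsDomain R] {G : Type*} [CommGroup G] (ι : R⁰ →* G)

theorem injective_affine_prod (a : R) (k : R⁰) :
    Function.Injective fun p : R × G => (a + k * p.1, ι k * p.2) := by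
  rintro ⟨r, x⟩ ⟨r', x'⟩ h
  simpa [nonZeroDivisors.coe_ne_zero] using h

/-- The image of `u^a s_k` in the regular representation on `ℓ²(R × G)`. It remembers the image of
`k` in `G` in the second coordinate, so that it sees the `G`-grading. -/
def regular (a : R) (k : R⁰) : ℓ²(R × G, ℂ) →L[ℂ] ℓ²(R × G, ℂ) :=
  push _ (injective_affine_prod ι a k)

theorem regular_basisVec (a r : R) (k : R⁰) (x : G) :
    regular ι a k (basisVec (r, x)) = basisVec (a + k * r, ι k * x) :=
  push_basisVec _ _ _

theorem regular_mul_regular (a b : R) (k l : R⁰) :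
    regular ι a k * regular ι b l = regular ι (a + k * b) (k * l) :=
  ext_basisVec fun ⟨r, x⟩ => by
    simp only [mul_apply_eq_comp, regular_basisVec, map_mul, Submonoid.coe_mul, mul_add, mul_assoc,
      add_assoc]

theorem regular_zero_one : regular ι 0 1 = 1 :=
  ext_basisVec fun ⟨r, x⟩ => by simp [regular_basisVec]

theorem star_regular_basisVec (a r : R) (k : R⁰) (x : G) :
    star (regular ι a k) (basisVec (a + k * r, x)) = basisVec (r, (ι k)⁻¹ * x) := by
  have adjoint_apply := adjoint_push_basisVec _ (injective_affine_prod ι a k) (r, (ι k)⁻¹ * x)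
  rwa [mul_inv_cancel_left] at adjoint_apply

theorem star_regular_basisVec_of_not_dvd {a r : R} {k : R⁰} (x : G) (h : ¬ (k : R) ∣ r - a) :
    star (regular ι a k) (basisVec (r, x)) = 0 := by
  refine adjoint_push_basisVec_of_notMem _ _ ?_
  rintro ⟨⟨q, y⟩, hq⟩
  exact h ⟨q, sub_eq_of_eq_add' (congrArg Prod.fst hq).symm⟩

theorem star_regular_mul_self (a : R) (k : R⁰) : star (regular ι a k) * regular ι a k = 1 :=
  adjoint_push_comp_push _ _

theorem sum_regular_mul_star_regular {m : R⁰} {T : Finset R}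
    (hT : Set.BijOn (Ideal.Quotient.mk (Ideal.span {(m : R)})) (T : Set R) Set.univ) :
    ∑ t ∈ T, regular ι t m * star (regular ι t m) = 1 :=
  ext_basisVec fun ⟨r, x⟩ => by
    obtain ⟨t, ht, q, rfl⟩ := exists_eq_add_mul_of_bijOn hT r
    rw [sum_apply, Finset.sum_eq_single_of_mem t ht fun u hu hut => ?_]
    · simp only [mul_apply_eq_comp, star_regular_basisVec, regular_basisVec, mul_inv_cancel_left,
        one_apply_eq_self]
    · have hdvd : ¬ (m : R) ∣ t + m * q - u := fun hdvd => hut.symm <|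
        eq_of_dvd_sub_of_bijOn hT ht hu <| by
          rwa [add_sub_right_comm, dvd_add_left (dvd_mul_right _ _)] at hdvd
      rw [mul_apply_eq_comp, star_regular_basisVec_of_not_dvd ι x hdvd, map_zero]

theorem star_regular_one (n : R) : star (regular ι n 1) = regular ι (-n) 1 := by
  have inverse : regular ι n 1 * regular ι (-n) 1 = 1 := by
    simp [regular_mul_regular, regular_zero_one]
  rw [← mul_one (star _), ← inverse, ← mul_assoc, star_regular_mul_self, one_mul]

theorem relations_regular : Relations (regular ι 0) fun n => regular ι n 1 where
  isometry m := star_regular_mul_self ι 0 m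
  unitary n := Unitary.mem_iff.2 ⟨star_regular_mul_self ι n 1, by
    simp [star_regular_one, regular_mul_regular, regular_zero_one]⟩
  s_mul k m := by simp [regular_mul_regular]
  v_add l n := by simp [regular_mul_regular]
  s_v m n := by simp [regular_mul_regular]
  sum_cosets m T hT := by
    rw [← sum_regular_mul_star_regular ι hT]
    refine Finset.sum_congr rfl fun t _ => ?_
    have h : regular ι t m = regular ι t 1 * regular ι 0 m := by simp [regular_mul_regular]
    rw [h, star_mul, star_regular_one]
    simp only [mul_assoc]

end

end AxbAlgebra

namespace RingCStarAlgebra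

open AxbAlgebra
open scoped lp

variable {R : Type u} [CommRing R] [IsDomain R] {G : Type u} [CommGroup G] (ι : R⁰ →* G)

/-- The regular representation of `𝔄[R]` on `ℓ²(R × G)` for a homomorphism `ι : R⁰ → G`. -/
noncomputable def regularRep :
    RingCStarAlgebra R →⋆ₐ[ℂ] (ℓ²(R × G, ℂ) →L[ℂ] ℓ²(R × G, ℂ)) :=
  (existsUnique_hom (relations_regular ι)).choose

theorem regularRep_affine (a : R) (k : R⁰) :
    regularRep ι (affine s v a k) = regular ι a k := by
  obtain ⟨hs, hv⟩ := (existsUnique_hom (relations_regular ι)).choose_spec.1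
  have h : regular ι a k = regular ι a 1 * regular ι 0 k := by simp [regular_mul_regular]
  rw [affine, map_mul, h]
  exact congrArg₂ (· * ·) (hv a) (hs k)

theorem regularRep_affine_mul_star_affine_basisVec (a b q : R) (k l : R⁰) (x : G) :
    regularRep ι (affine s v a k * star (affine s v b l)) (basisVec (b + l * q, x)) =
      basisVec (a + k * q, ι k / ι l * x) := by
  rw [map_mul, map_star, regularRep_affine, regularRep_affine, mul_apply_eq_comp,
    star_regular_basisVec, regular_basisVec, ← mul_assoc, ← div_eq_mul_inv]

theorem regularRep_affine_mul_star_affine_basisVec_of_not_dvd (a : R) {b r : R} (k : R⁰) {l : R⁰}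
    (x : G) (h : ¬ (l : R) ∣ r - b) :
    regularRep ι (affine s v a k * star (affine s v b l)) (basisVec (r, x)) = 0 := by
  rw [map_mul, map_star, regularRep_affine, regularRep_affine, mul_apply_eq_comp,
    star_regular_basisVec_of_not_dvd ι x h, map_zero]

theorem norm_regularRep_le (y : RingCStarAlgebra R) : ‖regularRep ι y‖ ≤ ‖y‖ :=
  NonUnitalStarAlgHom.norm_apply_le _ y

theorem continuous_regularRep : Continuous (regularRep ι) :=
  AddMonoidHomClass.continuous_of_bound _ 1 fun y => by
    rw [one_mul]
    exact norm_regularRep_le ι y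

instance : Nontrivial (RingCStarAlgebra R) := by
  have : Nontrivial ℓ²(R × PUnit.{u + 1}, ℂ) :=
    ⟨basisVec (0, PUnit.unit), 0, norm_ne_zero_iff.1 (norm_basisVec _ ▸ one_ne_zero)⟩
  exact (regularRep (1 : R⁰ →* PUnit.{u + 1})).toRingHom.domain_nontrivial

end RingCStarAlgebra

namespace AxbAlgebra

/-! ### Gradings -/

noncomputable section Gradings

variable {R : Type*} [CommRing R] {B : Type*} [CStarAlgebra B] {G : Type*} [CommGroup G]

/-- The component of degree `g ∈ G` for the grading, given by a homomorphism `ι : R⁰ → G`, in which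
`u^a s_k (u^b s_l)^*` has the degree `ι k / ι l`. -/
def degreeSpace (s : R⁰ → B) (v : R → B) (ι : R⁰ →* G) (g : G) : Submodule ℂ B :=
  Submodule.span ℂ
    {x | ∃ a b k l, ι k / ι l = g ∧ x = affine s v a k * star (affine s v b l)}

/-- The span of the `u^(b + n) s_k (u^b s_k)^*` for fixed `k` and `n`, that is, of the restrictions
of the translation by `n` to cosets of `(k)`. For fixed `k` these spaces form a grading by the
additive group of `R`, which is written multiplicatively to match the grading by degree. -/
def translationSpace (s : R⁰ → B) (v : R → B) (k : R⁰) (n : Multiplicative R) : Submodule ℂ B :=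
  Submodule.span ℂ
    (Set.range fun b => affine s v (b + n.toAdd) k * star (affine s v b k))

variable {s : R⁰ → B} {v : R → B}

theorem affine_mul_star_affine_mem_degreeSpace (ι : R⁰ →* G) (a b : R) (k l : R⁰) :
    affine s v a k * star (affine s v b l) ∈ degreeSpace s v ι (ι k / ι l) :=
  Submodule.subset_span ⟨a, b, k, l, rfl, rfl⟩

theorem affine_mul_star_affine_mem_translationSpace (b : R) (k : R⁰) (n : Multiplicative R) :
    affine s v (b + n.toAdd) k * star (affine s v b k) ∈ translationSpace s v k n :=
  Submodule.subset_span ⟨b, rfl⟩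

theorem star_mem_degreeSpace {ι : R⁰ →* G} {g : G} {x : B} (hx : x ∈ degreeSpace s v ι g) :
    star x ∈ degreeSpace s v ι g⁻¹ := by
  induction hx using Submodule.span_induction with
  | mem x hx =>
    obtain ⟨a, b, k, l, rfl, rfl⟩ := hx
    rw [star_mul, star_star, inv_div]
    exact affine_mul_star_affine_mem_degreeSpace ι b a l k
  | zero => exact (star_zero B).symm ▸ zero_mem _
  | add x y _ _ hx hy => exact (star_add x y).symm ▸ add_mem hx hy
  | smul c x _ hx => exact (star_smul c x).symm ▸ Submodule.smul_mem _ _ hx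

namespace Relations

variable [Ring.HasFiniteQuotients R]

theorem degreeSpace_mul_le (h : Relations s v) (ι : R⁰ →* G) (g g' : G) :
    degreeSpace s v ι g * degreeSpace s v ι g' ≤ degreeSpace s v ι (g * g') := by
  rw [degreeSpace, degreeSpace, Submodule.span_mul_span, Submodule.span_le]
  rintro _ ⟨_, ⟨a, b, k, l, rfl, rfl⟩, _, ⟨c, d, m, n, rfl, rfl⟩, rfl⟩
  refine h.affine_mul_star_affine_mul_mem a b c d k l m n fun a' d' => ?_
  rw [div_mul_div_comm, ← map_mul, ← map_mul]
  exact affine_mul_star_affine_mem_degreeSpace ι a' d' (k * m) (l * n)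

theorem translationSpace_mul_le (h : Relations s v) (k : R⁰) (n n' : Multiplicative R) :
    translationSpace s v k n * translationSpace s v k n' ≤ translationSpace s v k (n * n') := by
  rw [translationSpace, translationSpace, Submodule.span_mul_span, Submodule.span_le]
  rintro _ ⟨_, ⟨b, rfl⟩, _, ⟨c, rfl⟩, rfl⟩
  dsimp only
  rw [mul_assoc, ← mul_assoc (star _)]
  by_cases hk : (k : R) ∣ c + n'.toAdd - b
  · obtain ⟨q, hq⟩ := hk
    have middle : star (affine s v b k) * affine s v (c + n'.toAdd) k = affine s v q 1 := by
      simpa [eq_add_of_sub_eq' hq] using h.star_affine_mul_affine_add b q k 1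
    have target : b + n.toAdd + k * q = c + (n * n').toAdd := by
      rw [← hq, toAdd_mul]
      ring
    rw [middle, ← mul_assoc, h.affine_mul_affine, mul_one, target]
    exact affine_mul_star_affine_mem_translationSpace c k (n * n')
  · have orthogonal := h.star_affine_mul_affine_eq_zero 1 1 hk
    rw [mul_one] at orthogonal
    rw [orthogonal, zero_mul, mul_zero]
    exact zero_mem _

theorem translationSpace_le_mul_right (h : Relations s v) (k m : R⁰) (n : Multiplicative R) :
    translationSpace s v k n ≤ translationSpace s v (k * m) n := by
  rw [translationSpace, Submodule.span_le]
  rintro _ ⟨b, rfl⟩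
  obtain ⟨T, hT⟩ := exists_representatives m
  dsimp only
  rw [h.affine_mul_star_affine_eq_sum _ b k k hT]
  refine sum_mem fun t _ => ?_
  rw [add_right_comm]
  exact affine_mul_star_affine_mem_translationSpace (b + k * t) (k * m) n

theorem exists_mem_iSup_translationSpace (h : Relations s v) {ι : R⁰ →* G}
    (hι : Function.Injective ι) {x : B} (hx : x ∈ degreeSpace s v ι 1) :
    ∃ k, x ∈ ⨆ n, translationSpace s v k n := by
  have directed : Directed (· ≤ ·) fun k => ⨆ n, translationSpace s v k n := fun k m =>
    ⟨k * m, iSup_mono fun n => h.translationSpace_le_mul_right k m n, iSup_mono fun n => by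
      rw [mul_comm]
      exact h.translationSpace_le_mul_right m k n⟩
  rw [← Submodule.mem_iSup_of_directed _ directed]
  refine Submodule.span_le.2 ?_ hx
  rintro _ ⟨a, b, k, l, hkl, rfl⟩
  obtain rfl : k = l := hι (div_eq_one.1 hkl)
  refine Submodule.mem_iSup_of_mem k (Submodule.mem_iSup_of_mem (.ofAdd (a - b)) ?_)
  simpa using affine_mul_star_affine_mem_translationSpace (s := s) (v := v) b k (.ofAdd (a - b))

/-- The *-algebra spanned by the products `u^a s_k (u^b s_l)^*`. It is set up as the only component
of the trivial grading, so that it is closed under products and adjoints. -/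
def affineAlgebra (h : Relations s v) : StarSubalgebra ℂ B where
  __ := (degreeSpace s v (1 : R⁰ →* Unit) 1).toSubalgebra
    (by simpa [h.affine_one, h.v_zero] using
      affine_mul_star_affine_mem_degreeSpace (s := s) (v := v) (1 : R⁰ →* Unit) 0 0 1 1)
    fun _ _ hx hy => h.degreeSpace_mul_le 1 1 1 (Submodule.mul_mem_mul hx hy)
  star_mem' hx := star_mem_degreeSpace hx

theorem affine_mul_star_affine_mem_affineAlgebra (h : Relations s v) (a b : R) (k l : R⁰) :
    affine s v a k * star (affine s v b l) ∈ h.affineAlgebra :=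
  affine_mul_star_affine_mem_degreeSpace (1 : R⁰ →* Unit) a b k l

theorem affine_mem_affineAlgebra (h : Relations s v) (a : R) (k : R⁰) :
    affine s v a k ∈ h.affineAlgebra := by
  simpa [h.affine_one, h.v_zero] using h.affine_mul_star_affine_mem_affineAlgebra a 0 k 1

theorem mem_iSup_degreeSpace (h : Relations s v) (ι : R⁰ →* G) {x : B}
    (hx : x ∈ h.affineAlgebra) : x ∈ ⨆ g, degreeSpace s v ι g := by
  refine Submodule.span_le.2 ?_ hx
  rintro _ ⟨a, b, k, l, -, rfl⟩
  exact Submodule.mem_iSup_of_mem (ι k / ι l) (affine_mul_star_affine_mem_degreeSpace ι a b k l)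

end Relations

end Gradings

end AxbAlgebra

namespace RingCStarAlgebra

open AxbAlgebra

variable {R : Type u} [CommRing R]

/- The universal property maps `𝔄[R]` to the closure of `N`, and the uniqueness part says that
this map, followed by the inclusion, is the identity. -/
theorem dense_of_generators_mem {N : StarSubalgebra ℂ (RingCStarAlgebra R)}
    (hs : ∀ m, s m ∈ N) (hv : ∀ n, v n ∈ N) : Dense (N : Set (RingCStarAlgebra R)) := fun x => by
  let s' : R⁰ → N.topologicalClosure := fun m => ⟨s m, N.le_topologicalClosure (hs m)⟩
  let v' : R → N.topologicalClosure := fun n => ⟨v n, N.le_topologicalClosure (hv n)⟩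
  have h : Relations (s : R⁰ → RingCStarAlgebra R) v := relations
  have := N.isClosed_topologicalClosure
  have relations_closure : Relations s' v' := {
    isometry m := Subtype.ext (h.isometry m)
    unitary n := Unitary.mem_iff.2 ⟨Subtype.ext (Unitary.star_mul_self_of_mem (h.unitary n)),
      Subtype.ext (Unitary.mul_star_self_of_mem (h.unitary n))⟩
    s_mul k m := Subtype.ext (h.s_mul k m)
    v_add l n := Subtype.ext (h.v_add l n)
    s_v m n := Subtype.ext (h.s_v m n)
    sum_cosets m T hT := Subtype.ext (by simpa using h.sum_cosets m T hT) }
  obtain ⟨φ, ⟨hφs, hφv⟩, -⟩ := existsUnique_hom relations_closure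
  have incl_comp : N.topologicalClosure.subtype.comp φ = .id ℂ _ :=
    (existsUnique_hom h).unique
      ⟨fun m => congrArg Subtype.val (hφs m), fun n => congrArg Subtype.val (hφv n)⟩
      ⟨fun _ => rfl, fun _ => rfl⟩
  have val_φ : (φ x : RingCStarAlgebra R) = x := DFunLike.congr_fun incl_comp x
  exact val_φ ▸ (φ x).2

theorem dense_affineAlgebra [Ring.HasFiniteQuotients R] :
    Dense ((relations (R := R)).affineAlgebra : Set (RingCStarAlgebra R)) :=
  dense_of_generators_mem
    (fun m => relations.affine_zero m ▸ relations.affine_mem_affineAlgebra 0 m)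
    fun n => relations.affine_one n ▸ relations.affine_mem_affineAlgebra n 1

end RingCStarAlgebra

namespace RingCStarAlgebra

/-! ### Faithfulness of the regular representation -/

open AxbAlgebra
open ContinuousLinearMap (adjoint)
open scoped lp InnerProductSpace

variable {R : Type u} [CommRing R] [IsDomain R] {G : Type u} [CommGroup G] (ι : R⁰ →* G)

section MatrixCoeff

/-- The matrix coefficients `⟨e_i, ρ(·) e_j⟩` of the regular representation `ρ`. -/
noncomputable def matrixCoeff (i j : R × G) : RingCStarAlgebra R →L[ℂ] ℂ :=
  innerSL ℂ (basisVec i) ∘L ContinuousLinearMap.apply ℂ _ (basisVec j) ∘L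
    ⟨(regularRep ι).toAlgHom.toLinearMap, continuous_regularRep ι⟩

theorem matrixCoeff_apply (i j : R × G) (y : RingCStarAlgebra R) :
    matrixCoeff ι i j y = ⟪basisVec i, regularRep ι y (basisVec j)⟫_ℂ :=
  rfl

open Classical in
theorem matrixCoeff_affine_mul_star_affine (a b r t : R) (k l : R⁰) (x y : G) :
    matrixCoeff ι (r, x) (t, y) (affine s v a k * star (affine s v b l)) =
      if ∃ q, r = a + k * q ∧ t = b + l * q ∧ x = ι k / ι l * y then 1 else 0 := by
  rw [matrixCoeff_apply]
  by_cases hl : (l : R) ∣ t - b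
  · obtain ⟨q, hq⟩ := hl
    obtain rfl := eq_add_of_sub_eq' hq
    rw [regularRep_affine_mul_star_affine_basisVec, inner_basisVec]
    simp [nonZeroDivisors.coe_ne_zero]
  · rw [regularRep_affine_mul_star_affine_basisVec_of_not_dvd ι a k y hl, inner_zero_right,
      if_neg]
    rintro ⟨q, -, rfl, -⟩
    exact hl ⟨q, add_sub_cancel_left _ _⟩

theorem norm_matrixCoeff_le (i j : R × G) (y : RingCStarAlgebra R) :
    ‖matrixCoeff ι i j y‖ ≤ ‖regularRep ι y‖ :=
  calc ‖matrixCoeff ι i j y‖ ≤ ‖basisVec i‖ * ‖regularRep ι y (basisVec j)‖ :=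
        norm_inner_le_norm (basisVec i) (regularRep ι y (basisVec j))
    _ ≤ ‖regularRep ι y‖ := by
        simpa [norm_basisVec] using (regularRep ι y).le_opNorm (basisVec j)

end MatrixCoeff

section Translations

variable {k : R⁰} {n n' : Multiplicative R} {y : RingCStarAlgebra R}

theorem matrixCoeff_eq_zero_of_mem_translationSpace (hn : n' ≠ n)
    (hy : y ∈ translationSpace s v k n') (t : R) (x : G) :
    matrixCoeff ι (t + n.toAdd, x) (t, x) y = 0 := by
  have le_ker : translationSpace s v k n' ≤
      LinearMap.ker (matrixCoeff ι (t + n.toAdd, x) (t, x)).toLinearMap := by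
    refine Submodule.span_le.2 ?_
    rintro _ ⟨b, rfl⟩
    refine (matrixCoeff_affine_mul_star_affine ι _ _ _ _ _ _ _ _).trans (if_neg ?_)
    rintro ⟨q, hq, rfl, -⟩
    refine hn (Multiplicative.toAdd.injective ?_)
    linear_combination -hq
  exact le_ker hy

theorem eq_sum_matrixCoeff_smul_of_mem_translationSpace {T : Finset R}
    (hT : Set.BijOn (Ideal.Quotient.mk (Ideal.span {(k : R)})) (T : Set R) Set.univ)
    (hy : y ∈ translationSpace s v k n) :
    y = ∑ t ∈ T, matrixCoeff ι (t + n.toAdd, 1) (t, 1) y •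
      (affine s v (t + n.toAdd) k * star (affine s v t k)) := by
  classical
  induction hy using Submodule.span_induction with
  | mem y hy =>
    obtain ⟨b, rfl⟩ := hy
    obtain ⟨t, ht, q, rfl⟩ := exists_eq_add_mul_of_bijOn hT b
    simp only [matrixCoeff_affine_mul_star_affine]
    rw [Finset.sum_eq_single_of_mem t ht fun u hu hut => ?_, if_pos ?_, one_smul, add_right_comm,
      relations.affine_add_mul_star_affine_add]
    · exact ⟨-q, by ring, by ring, by simp⟩
    · rw [if_neg, zero_smul]
      rintro ⟨p, -, hp, -⟩
      exact hut (eq_of_dvd_sub_of_bijOn hT hu ht ⟨q + p, by linear_combination hp⟩)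
  | zero => simp
  | add y z _ _ hy hz =>
    nth_rw 1 [hy, hz]
    simp only [map_add, add_smul, Finset.sum_add_distrib]
  | smul c y _ hy =>
    nth_rw 1 [hy]
    simp only [map_smul, smul_assoc, Finset.smul_sum]

variable [Ring.HasFiniteQuotients R]

theorem norm_le_norm_regularRep_of_mem_iSup_translationSpace
    (hy : star y * y ∈ ⨆ n, translationSpace s v k n) : ‖y‖ ≤ ‖regularRep ι y‖ := by
  obtain ⟨T, hT⟩ := exists_representatives k
  refine norm_le_norm_map_of_graded (relations.translationSpace_mul_le k) T.card.cast_nonneg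
    (fun S x hx n hn => ?_) hy
  have coeff_sum : ∀ t, matrixCoeff ι (t + n.toAdd, 1) (t, 1) (x n) =
      matrixCoeff ι (t + n.toAdd, 1) (t, 1) (∑ n' ∈ S, x n') := fun t => by
    rw [map_sum, Finset.sum_eq_single_of_mem n hn fun n' _ hn' =>
      matrixCoeff_eq_zero_of_mem_translationSpace ι hn' (hx n') t 1]
  rw [eq_sum_matrixCoeff_smul_of_mem_translationSpace ι hT (hx n), ← nsmul_eq_mul]
  refine (norm_sum_le _ _).trans (Finset.sum_le_card_nsmul _ _ _ fun t _ => ?_)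
  rw [norm_smul, coeff_sum]
  exact (mul_le_of_le_one_right (norm_nonneg _)
    (relations.norm_affine_mul_star_affine_le_one _ _ _ _)).trans (norm_matrixCoeff_le ι _ _ _)

end Translations

section Degrees

variable {ι} {y z : RingCStarAlgebra R}

theorem matrixCoeff_eq_of_mem_degreeSpace_one (hy : y ∈ degreeSpace s v ι 1) (r t : R) :
    matrixCoeff ι (r, 1) (t, 1) y =
      matrixCoeff (1 : R⁰ →* PUnit.{u + 1}) (r, 1) (t, 1) y := by
  refine LinearMap.eqOn_span (f := (matrixCoeff ι (r, 1) (t, 1)).toLinearMap)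
    (g := (matrixCoeff (1 : R⁰ →* PUnit.{u + 1}) (r, 1) (t, 1)).toLinearMap) ?_ hy
  rintro _ ⟨a, b, k, l, hkl, rfl⟩
  refine (matrixCoeff_affine_mul_star_affine ι _ _ _ _ _ _ _ _).trans
    (.trans ?_ (matrixCoeff_affine_mul_star_affine 1 _ _ _ _ _ _ _ _).symm)
  classical exact if_congr (exists_congr fun q => by simp [hkl]) rfl rfl

theorem matrixCoeff_eq_zero_of_mem_degreeSpace {g : G} (hg : g ≠ 1)
    (hy : y ∈ degreeSpace s v ι g) (r t : R) : matrixCoeff ι (r, 1) (t, 1) y = 0 := by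
  have le_ker : degreeSpace s v ι g ≤
      LinearMap.ker (matrixCoeff ι (r, 1) (t, 1)).toLinearMap := by
    refine Submodule.span_le.2 ?_
    rintro _ ⟨a, b, k, l, rfl, rfl⟩
    refine (matrixCoeff_affine_mul_star_affine ι _ _ _ _ _ _ _ _).trans (if_neg ?_)
    rintro ⟨q, -, -, h⟩
    exact hg (by rw [h, mul_one])
  exact le_ker hy

/- The left-hand representation is then the compression of the right-hand one to `R × {1}`. -/
theorem norm_regularRep_one_le_of_matrixCoeff_eq
    (h : ∀ r t : R, matrixCoeff (1 : R⁰ →* PUnit.{u + 1}) (r, 1) (t, 1) y =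
      matrixCoeff ι (r, 1) (t, 1) z) :
    ‖regularRep (1 : R⁰ →* PUnit.{u + 1}) y‖ ≤ ‖regularRep ι z‖ := by
  let J : ℓ²(R × PUnit.{u + 1}, ℂ) →L[ℂ] ℓ²(R × G, ℂ) :=
    push (fun p => (p.1, 1)) fun _ _ hp => Prod.ext (Prod.ext_iff.1 hp).1 rfl
  have J_basisVec : ∀ p, J (basisVec p) = basisVec (p.1, 1) := push_basisVec _ _
  have compression :
      regularRep (1 : R⁰ →* PUnit.{u + 1}) y = adjoint J ∘L regularRep ι z ∘L J :=
    ext_basisVec fun j => ext_inner_basisVec fun i => by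
      rw [ContinuousLinearMap.comp_apply, ContinuousLinearMap.adjoint_inner_right,
        ContinuousLinearMap.comp_apply, J_basisVec, J_basisVec]
      exact h i.1 j.1
  have hJ : ‖J‖ ≤ 1 := norm_push_le_one _ _
  calc ‖regularRep (1 : R⁰ →* PUnit.{u + 1}) y‖
      ≤ ‖adjoint J‖ * (‖regularRep ι z‖ * ‖J‖) := by
        rw [compression]
        exact (ContinuousLinearMap.opNorm_comp_le _ _).trans
          (mul_le_mul_of_nonneg_left (ContinuousLinearMap.opNorm_comp_le _ _) (norm_nonneg _))
    _ ≤ 1 * (‖regularRep ι z‖ * 1) := by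
        rw [LinearIsometryEquiv.norm_map]
        gcongr
    _ = ‖regularRep ι z‖ := by ring

variable [Ring.HasFiniteQuotients R]

theorem norm_le_norm_regularRep_sum (hι : Function.Injective ι) {S : Finset G}
    {x : G → RingCStarAlgebra R} (hx : ∀ g, x g ∈ degreeSpace s v ι g) {g : G} (hg : g ∈ S) :
    ‖x g‖ ≤ ‖regularRep ι (∑ g' ∈ S, x g')‖ := by
  rcases (norm_nonneg (x g)).eq_or_lt with h0 | hpos
  · exact h0 ▸ norm_nonneg _
  have star_mul_mem : ∀ g', star (x g) * x g' ∈ degreeSpace s v ι (g⁻¹ * g') := fun g' =>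
    relations.degreeSpace_mul_le ι _ _
      (Submodule.mul_mem_mul (star_mem_degreeSpace (hx g)) (hx g'))
  have degree_one : star (x g) * x g ∈ degreeSpace s v ι 1 := by
    simpa only [inv_mul_cancel] using star_mul_mem g
  have coeff_sum : ∀ r t, matrixCoeff (1 : R⁰ →* PUnit.{u + 1}) (r, 1) (t, 1) (star (x g) * x g) =
      matrixCoeff ι (r, 1) (t, 1) (star (x g) * ∑ g' ∈ S, x g') := fun r t => by
    rw [Finset.mul_sum, map_sum, Finset.sum_eq_single_of_mem g hg fun g' _ hg' =>
        matrixCoeff_eq_zero_of_mem_degreeSpace (mt inv_mul_eq_one.1 hg'.symm) (star_mul_mem g') r t,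
      matrixCoeff_eq_of_mem_degreeSpace_one degree_one]
  obtain ⟨k, hk⟩ := relations.exists_mem_iSup_translationSpace hι degree_one
  refine le_of_mul_le_mul_left ?_ hpos
  calc ‖x g‖ * ‖x g‖
      ≤ ‖regularRep (1 : R⁰ →* PUnit.{u + 1}) (x g)‖ *
          ‖regularRep (1 : R⁰ →* PUnit.{u + 1}) (x g)‖ :=
        mul_self_le_mul_self (norm_nonneg _)
          (norm_le_norm_regularRep_of_mem_iSup_translationSpace 1 hk)
    _ = ‖regularRep (1 : R⁰ →* PUnit.{u + 1}) (star (x g) * x g)‖ := by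
        rw [map_mul, map_star]
        exact CStarRing.norm_star_mul_self.symm
    _ ≤ ‖regularRep ι (star (x g) * ∑ g' ∈ S, x g')‖ :=
        norm_regularRep_one_le_of_matrixCoeff_eq coeff_sum
    _ ≤ ‖x g‖ * ‖regularRep ι (∑ g' ∈ S, x g')‖ := by
        rw [map_mul]
        refine (norm_mul_le _ _).trans (mul_le_mul_of_nonneg_right ?_ (norm_nonneg _))
        exact (norm_regularRep_le ι _).trans (norm_star _).le

theorem norm_regularRep (hι : Function.Injective ι) (y : RingCStarAlgebra R) :
    ‖regularRep ι y‖ = ‖y‖ := by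
  refine (norm_regularRep_le ι y).antisymm ?_
  refine dense_affineAlgebra.induction (P := fun y => ‖y‖ ≤ ‖regularRep ι y‖) (fun y hy => ?_)
    (isClosed_le continuous_norm (continuous_regularRep ι).norm) y
  refine norm_le_norm_map_of_graded (relations.degreeSpace_mul_le ι) zero_le_one
    (fun S x hx g hg => ?_) (relations.mem_iSup_degreeSpace ι (mul_mem (star_mem hy) hy))
  rw [one_mul]
  exact norm_le_norm_regularRep_sum hι hx hg

end Degrees

end RingCStarAlgebra

namespace AxbAlgebra

/-! ### Compression to scalars -/

section Domain

variable {R : Type*} [CommRing R]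

theorem exists_injective_monoidHom_units :
    ∃ ι : R⁰ →* (FractionRing R)ˣ, Function.Injective ι :=
  ⟨IsUnit.liftRight ((algebraMap R (FractionRing R)).toMonoidHom.comp R⁰.subtype)
    (IsLocalization.map_units (FractionRing R)), fun _ _ h =>
      Subtype.ext (IsFractionRing.injective R (FractionRing R) (congrArg Units.val h))⟩

variable [IsDomain R]

theorem exists_not_dvd_of_not_isField (hR : ¬ IsField R) {d : R} (hd : d ≠ 0) :
    ∃ m : R⁰, ¬ (m : R) ∣ d := by
  obtain ⟨p, hp0, hp⟩ := Ring.exists_not_isUnit_of_not_isField hR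
  refine ⟨⟨d * p, mem_nonZeroDivisors_of_ne_zero (mul_ne_zero hd hp0)⟩, ?_⟩
  rintro ⟨q, hq⟩
  have one_eq : p * q = 1 := mul_left_cancel₀ hd (by rw [← mul_assoc, ← hq, mul_one])
  exact hp (.of_mul_eq_one q one_eq)

theorem subsingleton_setOf_mul_sub_eq_mul_sub {a b k l : R} (hk : k ≠ 0)
    (h : ¬ (k = l ∧ a = b)) : {c | l * (c - a) = k * (c - b)}.Subsingleton := by
  intro c (hc : _ = _) d (hd : _ = _)
  have difference : (l - k) * (c - d) = 0 := by linear_combination hc - hd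
  rcases mul_eq_zero.1 difference with hlk | hcd
  · obtain rfl := sub_eq_zero.1 hlk
    exact absurd ⟨rfl, sub_right_injective (mul_left_cancel₀ hk hc)⟩ h
  · exact sub_eq_zero.1 hcd

end Domain

section Compression

variable {R : Type*} [CommRing R] {B : Type*} [CStarAlgebra B] {s : R⁰ → B} {v : R → B}

open Classical in
theorem Relations.star_affine_mul_affine_mul_star_affine_mul_affine [Ring.HasFiniteQuotients R]
    (h : Relations s v) {a b c : R} {k l N m : R⁰} (hk : k ∣ N) (hl : l ∣ N)
    (hm : (m : R) ∣ l * (c - a) - k * (c - b) → k = l ∧ a = b) :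
    star (affine s v c (N * m)) * (affine s v a k * star (affine s v b l)) *
      affine s v c (N * m) = if (k = l ∧ a = b) ∧ (l : R) ∣ c - b then 1 else 0 := by
  have outer_eq_zero : ∀ {n : R⁰} {e : R}, n ∣ N → ¬ (n : R) ∣ c - e →
      star (affine s v e n) * affine s v c (N * m) = 0 := by
    rintro n e ⟨n', rfl⟩ hn
    simpa [mul_assoc] using h.star_affine_mul_affine_eq_zero 1 (n' * m) hn
  have outer_eq : ∀ {n n' : R⁰} {e p : R}, N = n * n' → c - e = n * p →
      star (affine s v e n) * affine s v c (N * m) = affine s v p (m * n') := by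
    rintro n n' e p rfl hp
    rw [eq_add_of_sub_eq' hp, mul_assoc, h.star_affine_mul_affine_add, mul_comm]
  rw [← mul_assoc, mul_assoc, ← star_star (affine s v a k), ← star_mul]
  by_cases hbl : (l : R) ∣ c - b; swap
  · rw [outer_eq_zero hl hbl, mul_zero, if_neg fun hif => hbl hif.2]
  by_cases hak : (k : R) ∣ c - a; swap
  · rw [outer_eq_zero hk hak, star_zero, zero_mul, if_neg]
    rintro ⟨⟨rfl, rfl⟩, -⟩
    exact hak hbl
  obtain ⟨⟨k', hk'⟩, ⟨l', hl'⟩⟩ := And.intro hk hl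
  obtain ⟨⟨p, hp⟩, ⟨q, hq⟩⟩ := And.intro hak hbl
  by_cases same : k = l ∧ a = b
  · rw [if_pos ⟨same, hbl⟩]
    obtain ⟨rfl, rfl⟩ := same
    rw [outer_eq hk' hp, h.star_affine_mul_self]
  · rw [if_neg fun hif => same hif.1, outer_eq hk' hp, outer_eq hl' hq]
    refine h.star_affine_mul_affine_eq_zero k' l' fun ⟨e, he⟩ => same (hm ⟨-(k * l * e), ?_⟩)
    rw [hp, hq]
    linear_combination (-(k : R) * l) * he

open Filter in
/-- Generic compression of `z` to the scalar `t`: there is a nonzero `L` such that almost every `c`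
in `r + (L)` satisfies `w^* z w = t` for all the isometries `w = u^c s_(Nm)` with `L ∣ N`, provided
that `m` does not divide a certain nonzero element `d` that depends on `c`. -/
def GenericallyCompresses (s : R⁰ → B) (v : R → B) (r : R) (z : B) (t : ℂ) : Prop :=
  ∃ L : R⁰, ∀ᶠ c in cofinite, (L : R) ∣ c - r → ∃ d ≠ 0, ∀ N m : R⁰, L ∣ N → ¬ (m : R) ∣ d →
    star (affine s v c (N * m)) * z * affine s v c (N * m) = t • 1

namespace GenericallyCompresses

variable {r : R} {y z : B} {t u : ℂ}

theorem zero [Nontrivial R] : GenericallyCompresses s v r 0 0 :=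
  ⟨1, .of_forall fun _ _ => ⟨1, one_ne_zero, fun _ _ _ _ => by simp⟩⟩

theorem smul (a : ℂ) (hz : GenericallyCompresses s v r z t) :
    GenericallyCompresses s v r (a • z) (a • t) := by
  obtain ⟨L, hL⟩ := hz
  refine ⟨L, ?_⟩
  filter_upwards [hL] with c hLc hcr
  obtain ⟨d, hd, hzd⟩ := hLc hcr
  refine ⟨d, hd, fun N m hN hm => ?_⟩
  rw [mul_smul_comm, smul_mul_assoc, hzd N m hN hm, smul_assoc]

theorem add [IsDomain R] (hy : GenericallyCompresses s v r y t)
    (hz : GenericallyCompresses s v r z u) : GenericallyCompresses s v r (y + z) (t + u) := by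
  obtain ⟨K, hK⟩ := hy
  obtain ⟨L, hL⟩ := hz
  refine ⟨K * L, ?_⟩
  filter_upwards [hK, hL] with c hKc hLc hcr
  obtain ⟨d, hd, hyd⟩ := hKc ((Dvd.intro (L : R) rfl).trans hcr)
  obtain ⟨e, he, hze⟩ := hLc ((Dvd.intro_left (K : R) rfl).trans hcr)
  refine ⟨d * e, mul_ne_zero hd he, fun N m hN hm => ?_⟩
  rw [mul_add, add_mul, hyd N m ((Dvd.intro L rfl).trans hN) fun h => hm (h.mul_right e),
    hze N m ((Dvd.intro_left K rfl).trans hN) fun h => hm (h.mul_left d), add_smul]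

theorem exists_isometry [IsDomain R] (hR : ¬ IsField R) (h : Relations s v)
    (hz : GenericallyCompresses s v r z t) : ∃ w, star w * w = 1 ∧ star w * z * w = t • 1 := by
  have : Infinite R := not_finite_iff_infinite.1 fun _ => hR (Finite.isField_of_domain R)
  obtain ⟨L, hL⟩ := hz
  have coset_infinite : (Set.range fun q : R => r + L * q).Infinite :=
    Set.infinite_range_of_injective fun p q hpq => by
      simpa [nonZeroDivisors.coe_ne_zero] using hpq
  obtain ⟨c, ⟨q, rfl⟩, hc⟩ := (coset_infinite.frequently_cofinite.and_eventually hL).exists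
  obtain ⟨d, hd, compress⟩ := hc ⟨q, add_sub_cancel_left _ _⟩
  obtain ⟨m, hm⟩ := exists_not_dvd_of_not_isField hR hd
  exact ⟨_, h.star_affine_mul_self _ _, compress L m dvd_rfl hm⟩

end GenericallyCompresses

variable [IsDomain R] [Ring.HasFiniteQuotients R] {r : R}

open Classical Filter in
/- Unless it is the projection onto a coset, `u^a s_k (u^b s_l)^*` implements a partial bijection
with at most one fixed point; at any other point `c` the element `d` measures how far `c` moves. -/
theorem Relations.genericallyCompresses_affine_mul_star_affine (h : Relations s v) (a b : R)
    (k l : R⁰) : GenericallyCompresses s v r (affine s v a k * star (affine s v b l))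
      (if (k = l ∧ a = b) ∧ (l : R) ∣ r - b then 1 else 0) := by
  have displacement : ∀ᶠ c in cofinite, ∃ d : R, d ≠ 0 ∧
      ∀ m : R, ¬ m ∣ d → m ∣ l * (c - a) - k * (c - b) → k = l ∧ a = b := by
    by_cases same : k = l ∧ a = b
    · exact .of_forall fun c => ⟨1, one_ne_zero, fun _ _ _ => same⟩
    · have fixed_points := subsingleton_setOf_mul_sub_eq_mul_sub
        (nonZeroDivisors.coe_ne_zero k) (mt (And.imp_left Subtype.ext) same)
      filter_upwards [fixed_points.finite.compl_mem_cofinite] with c hc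
      exact ⟨_, sub_ne_zero.2 hc, fun _ h h' => absurd h' h⟩
  refine ⟨k * l, ?_⟩
  filter_upwards [displacement] with c ⟨d, hd, hdm⟩ hcr
  refine ⟨d, hd, fun N m hN hm => ?_⟩
  have dvd_iff : (l : R) ∣ c - b ↔ (l : R) ∣ r - b := by
    rw [← sub_add_sub_cancel c r b]
    exact dvd_add_right ((Dvd.intro_left (k : R) rfl).trans hcr)
  rw [h.star_affine_mul_affine_mul_star_affine_mul_affine ((Dvd.intro l rfl).trans hN)
    ((Dvd.intro_left k rfl).trans hN) (hdm m hm)]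
  simp only [dvd_iff, ite_smul, one_smul, zero_smul]

open Classical in
theorem Relations.genericallyCompresses_of_mem_affineAlgebra (h : Relations s v) {φ : B →ₗ[ℂ] ℂ}
    (hφ : ∀ a b k l, φ (affine s v a k * star (affine s v b l)) =
      if (k = l ∧ a = b) ∧ (l : R) ∣ r - b then 1 else 0)
    {z : B} (hz : z ∈ h.affineAlgebra) : GenericallyCompresses s v r z (φ z) := by
  change z ∈ degreeSpace s v (1 : R⁰ →* Unit) 1 at hz
  induction hz using Submodule.span_induction with
  | mem z hz =>
    obtain ⟨a, b, k, l, -, rfl⟩ := hz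
    exact hφ a b k l ▸ h.genericallyCompresses_affine_mul_star_affine a b k l
  | zero => exact (map_zero φ).symm ▸ .zero
  | add y z _ _ hy hz => exact (map_add φ y z).symm ▸ hy.add hz
  | smul a z _ hz => exact (map_smul φ a z).symm ▸ hz.smul a

end Compression

end AxbAlgebra

namespace RingCStarAlgebra

open AxbAlgebra

variable {R : Type u} [CommRing R] [IsDomain R] {G : Type u} [CommGroup G] {ι : R⁰ →* G}

open Classical in
theorem matrixCoeff_self_affine_mul_star_affine (hι : Function.Injective ι) (a b r : R) (k l : R⁰)
    (x : G) :
    matrixCoeff ι (r, x) (r, x) (affine s v a k * star (affine s v b l)) =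
      if (k = l ∧ a = b) ∧ (l : R) ∣ r - b then 1 else 0 := by
  rw [matrixCoeff_affine_mul_star_affine]
  refine if_congr ⟨?_, ?_⟩ rfl rfl
  · rintro ⟨q, ha, hb, hx⟩
    obtain rfl : k = l := hι (div_eq_one.1 (right_eq_mul.1 hx))
    exact ⟨⟨rfl, add_right_cancel (ha.symm.trans hb)⟩, q, sub_eq_of_eq_add' hb⟩
  · rintro ⟨⟨rfl, rfl⟩, q, hq⟩
    exact ⟨q, eq_add_of_sub_eq' hq, eq_add_of_sub_eq' hq, by simp⟩

theorem exists_matrixCoeff_star_mul_self_ne_zero {y : RingCStarAlgebra R}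
    (hy : regularRep ι y ≠ 0) : ∃ i, matrixCoeff ι i i (star y * y) ≠ 0 := by
  obtain ⟨i, hi⟩ : ∃ i, regularRep ι y (basisVec i) ≠ 0 := by
    by_contra! h
    exact hy (ext_basisVec h)
  refine ⟨i, ?_⟩
  rw [matrixCoeff_apply, map_mul, map_star, mul_apply_eq_comp,
    ContinuousLinearMap.star_eq_adjoint, ContinuousLinearMap.adjoint_inner_right]
  exact inner_self_ne_zero.2 hi

theorem exists_mul_mul_eq_one [Ring.HasFiniteQuotients R] (hR : ¬ IsField R)
    {x : RingCStarAlgebra R} (hx : x ≠ 0) : ∃ a b, a * x * b = 1 := by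
  obtain ⟨ι, hι⟩ := exists_injective_monoidHom_units (R := R)
  have regularRep_ne_zero : regularRep ι x ≠ 0 := by
    rwa [← norm_ne_zero_iff, norm_regularRep hι, norm_ne_zero_iff]
  obtain ⟨⟨r, g⟩, hr⟩ := exists_matrixCoeff_star_mul_self_ne_zero regularRep_ne_zero
  let φ := matrixCoeff ι (r, g) (r, g)
  obtain ⟨a, b, hab⟩ := exists_mul_mul_eq_one_of_dense dense_affineAlgebra φ.continuous
    (fun z hz => (relations.genericallyCompresses_of_mem_affineAlgebra (φ := φ.toLinearMap)
      (fun a b k l => matrixCoeff_self_affine_mul_star_affine hι a b r k l g) hz).exists_isometry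
        hR relations) hr
  exact ⟨a * star x, b, by rw [mul_assoc a, hab]⟩

end RingCStarAlgebra

/-- For an integral domain `R` that is not a field and whose nonzero principal ideals have finite
index, the universal C*-algebra `𝔄[R]` is simple and purely infinite. -/
theorem mainTheorem1 {R : Type u} [CommRing R] [IsDomain R] (hR : ¬ IsField R)
    (hfin : ∀ m : R, m ≠ 0 → Finite (R ⧸ Ideal.span {m})) :
    IsSimpleCStarAlgebra (RingCStarAlgebra R) ∧
      IsPurelyInfiniteCStarAlgebra (RingCStarAlgebra R) := by
  have := AxbAlgebra.hasFiniteQuotients_of_finite_quotient_span_singleton hfin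
  obtain ⟨m, hm⟩ := AxbAlgebra.exists_not_dvd_of_not_isField hR (one_ne_zero (α := R))
  have purelyInfinite : IsPurelyInfiniteCStarAlgebra (RingCStarAlgebra R) :=
    ⟨AxbAlgebra.isEmpty_starAlgEquiv_complex_of_not_commute
      (RingCStarAlgebra.relations.not_commute_s_v hm),
      fun _ hx => RingCStarAlgebra.exists_mul_mul_eq_one hR hx⟩
  exact ⟨purelyInfinite.isSimple, purelyInfinite⟩
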